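/- Let $n\ge 1$ and let $z=(z_1,\dots,z_n)$, $\overline z=(\overline z_1,\dots,\overline z_n)$ be independent complex variables, $\kappa_j=z_j\overline z_j$. Let $\mathcal N$ be the set of formal power series $\sum_{k,\overline k}H_{k,\overline k}z^k\overline z^{\overline k}$ with complex coefficients which contain only monomials with $k=\overline k$, i.e. which are series in $\kappa=(\kappa_1,\dots,\kappa_n)$, and let $\partial_j=\partial/\partial\kappa_j$ on $\mathcal N$, $\langle q,\partial\rangle=\sum_j q_j\partial_j$. Let $\mathcal A$ be the set of series with $|H_{k,\overline k}|\le c\,e^{a(|k|+|\overline k|)}$ for some constants $c,a$. For $\rho>0$ let $D_\rho=\{(z,\overline z)\in\mathbb C^{2n}:|z_j|<\rho,\ |\overline z_j|<\rho \text{ for all } j\}$, and let $\mathcal A^\rho$ be the space of power series converging absolutely in $D_\rho$ to a bounded function, with the norm $\|H\|_\rho=\sup_{D_\rho}|H|$. Let $\omega\in\mathbb R^n$ be nonresonant, i.e. $\langle\omega,p\rangle\neq0$ for all $p\in\mathbb Z^n\setminus\{0\}$; let $q\in\mathbb Z^n\setminus\{0\}$ satisfy $\langle\omega,q\rangle>0$,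 and put $\omega_q=|\langle\omega,q\rangle|$, $\kappa^{[q]}=\prod_j\kappa_j^{|q_j|}$. For $p=\pm q$ let $\mathbf z^{\mathbf k_p}=\prod_j z_j^{\max(-p_j,0)}\,\overline z_j^{\max(p_j,0)}$. Suppose $\widehat N^{q},\widehat N^{-q},\widehat N^0\in\mathcal N\cap\mathcal A$, the series $\mathbf z^{\mathbf k_{q}}\widehat N^{q}$ and $\mathbf z^{\mathbf k_{-q}}\widehat N^{-q}$ have no terms of total degree less than $3$ in $(z,\overline z)$, and $\widehat N^0$ has no terms of degree less than $2$ in $\kappa$. (These are the data of an initial Hamiltonian $\sum_j\omega_jz_j\overline z_j+\mathbf z^{\mathbf k_q}\widehat N^q+\widehat N^0+\mathbf z^{\mathbf k_{-q}}\widehat N^{-q}$ which contains only the harmonics $q,0,-q$.) Then there exists $\widehat\rho>0$ such that the initial value problem $$\partial_\delta N^{\pm q}=-N^{\pm q}\langle q,\partial\rangle N^0,\qquad \partial_\delta N^0=-2e^{-2\omega_q\delta}\,\langle q,\partial\rangle\big(\kappa^{[q]}N^{-q}N^q\big),\qquad N^{\pm q}|_{\delta=0}=\widehat N^{\pm q},\quad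 N^0|_{\delta=0}=\widehat N^0,$$ understood as a system of differential equations for the Taylor coefficients, has a solution $N^{q},N^{-q},N^0$ on $[0,+\infty)$ with $N^{q}(\delta),N^{-q}(\delta),N^0(\delta)\in\mathcal N\cap\mathcal A^{\widehat\rho}$ for all $\delta\ge0$. Moreover, $$\lim_{\delta\to+\infty}\big\|e^{-\omega_q\delta}N^{\pm q}(\delta)\big\|_{\widehat\rho}=0,$$ and there is $N^\infty\in\mathcal N\cap\mathcal A^{\widehat\rho}$ such that $\lim_{\delta\to+\infty}\|N^0(\delta)-N^\infty\|_{\widehat\rho}=0$. -/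

import Mathlib

namespace NormalizationFlow

noncomputable section

/-- The space of formal power series in `z_1, …, z_n, z̄_1, …, z̄_n`: the variable `Sum.inl j` is `z_j`
and the variable `Sum.inr j` is `z̄_j` (an independent variable). -/
abbrev FormalSeries (n : ℕ) : Type := MvPowerSeries (Fin n ⊕ Fin n) ℂ

/-- Multi-indices `(k, k̄)`. -/
abbrev MultiIndex (n : ℕ) : Type := (Fin n ⊕ Fin n) →₀ ℕ

/-- The frequency vector `ω` is nonresonant. -/
def Nonresonant {n : ℕ} (ω : Fin n → ℝ) : Prop :=
  ∀ q : Fin n → ℤ, q ≠ 0 → ∑ j, ω j * (q j : ℝ) ≠ 0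

/-- `ω_q = |⟨ω, q⟩|`. -/
def freq {n : ℕ} (ω : Fin n → ℝ) (q : Fin n → ℤ) : ℝ := |∑ j, ω j * (q j : ℝ)|

/-- `σ_q = sign ⟨ω, q⟩`. -/
def freqSign {n : ℕ} (ω : Fin n → ℝ) (q : Fin n → ℤ) : SignType :=
  SignType.sign (∑ j, ω j * (q j : ℝ))

/-- The series depending on `z, z̄` only through the products `κ_j = z_j z̄_j`. -/
def normalForms (n : ℕ) : Set (FormalSeries n) :=
  {H | ∀ k : MultiIndex n, MvPowerSeries.coeff k H ≠ 0 → ∀ j : Fin n, k (Sum.inl j) = k (Sum.inr j)}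

/-- The analytic series: `|H_k| ≤ c e^{a|k|}` for some `c`, `a`. -/
def analyticSeries (n : ℕ) : Set (FormalSeries n) :=
  {H | ∃ c a : ℝ, ∀ k : MultiIndex n, ‖MvPowerSeries.coeff k H‖ ≤ c * Real.exp (a * (k.degree : ℝ))}

/-- The open polydisk `D_ρ` in `ℂ^{2n}`. -/
def polydisk (n : ℕ) (ρ : ℝ) : Set (Fin n ⊕ Fin n → ℂ) := {z | ∀ j, ‖z j‖ < ρ}

/-- The term `H_k z^k` of the series `H` at the point `z`. -/
def term {n : ℕ} (H : FormalSeries n) (z : Fin n ⊕ Fin n → ℂ) (k : MultiIndex n) : ℂ :=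
  MvPowerSeries.coeff k H * k.prod (fun j e => z j ^ e)

/-- The value `H(z)` (meaningful where the series converges absolutely). -/
def value {n : ℕ} (H : FormalSeries n) (z : Fin n ⊕ Fin n → ℂ) : ℂ := ∑' k, term H z k

/-- The space `A^ρ`: series that converge absolutely in `D_ρ` to a bounded function. -/
def boundedAnalytic (n : ℕ) (ρ : ℝ) : Set (FormalSeries n) :=
  {H | (∀ z ∈ polydisk n ρ, Summable (term H z)) ∧
    BddAbove ((fun z => ‖value H z‖) '' polydisk n ρ)}

/-- The norm `‖H‖_ρ = sup_{z ∈ D_ρ} |H(z)|` on `A^ρ`. -/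
def supNorm {n : ℕ} (ρ : ℝ) (H : FormalSeries n) : ℝ :=
  sSup ((fun z => ‖value H z‖) '' polydisk n ρ)

/-- The multi-index `(l, l)`, the exponent of `κ^l`. -/
def diag {n : ℕ} (l : Fin n → ℕ) : MultiIndex n := Finsupp.equivFunOnFinite.symm (Sum.elim l l)

/-- The monomial `κ^l = ∏_j (z_j z̄_j)^{l_j}`. -/
def kappaPow {n : ℕ} (l : Fin n → ℕ) : FormalSeries n := MvPowerSeries.monomial (diag l) 1

/-- The minimal index `(k_q, k̄_q)` with `k̄_q - k_q = q` and `min (k_q)_j (k̄_q)_j = 0`. -/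
def minIndex {n : ℕ} (q : Fin n → ℤ) : MultiIndex n :=
  Finsupp.equivFunOnFinite.symm (Sum.elim (fun j => (-q j).toNat) (fun j => (q j).toNat))

/-- The monomial `z^{k_q} z̄^{k̄_q}`. -/
def harmonicMonomial {n : ℕ} (q : Fin n → ℤ) : FormalSeries n :=
  MvPowerSeries.monomial (minIndex q) 1

/-- `H = O_m(z, z̄)`: all terms of total degree less than `m` vanish. -/
def IsOrder {n : ℕ} (m : ℕ) (H : FormalSeries n) : Prop :=
  ∀ k : MultiIndex n, k.degree < m → MvPowerSeries.coeff k H = 0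

/-- `N = O_m(κ)` for a normal form `N`: the terms in `κ^l` with `|l| < m` vanish. -/
def IsOrderKappa {n : ℕ} (m : ℕ) (N : FormalSeries n) : Prop :=
  ∀ l : Fin n → ℕ, ∑ j, l j < m → MvPowerSeries.coeff (diag l) N = 0

/-- The derivative `∂/∂κ_j` of a normal form:
it sends `∑ N_l κ^l` to `∑ (l_j + 1) N_{l + e_j} κ^l`. It is only used on normal forms. -/
def kappaDeriv {n : ℕ} (j : Fin n) (N : FormalSeries n) : FormalSeries n :=
  fun k => ((k (Sum.inl j) : ℂ) + 1) * MvPowerSeries.coeff (k + diag (Pi.single j 1)) N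

/-- `⟨q, ∂⟩ N = ∑_j q_j ∂N/∂κ_j`. -/
def dirDeriv {n : ℕ} (q : Fin n → ℤ) (N : FormalSeries n) : FormalSeries n :=
  ∑ j, (q j : ℂ) • kappaDeriv j N

/-- The curve `γ` of formal series satisfies `∂_δ γ = Φ` for all `δ ≥ 0` (one-sided at `δ = 0`),
in the sense of Taylor coefficients. -/
def SatisfiesODE {n : ℕ} (γ Φ : ℝ → FormalSeries n) : Prop :=
  ∀ δ : ℝ, 0 ≤ δ → ∀ k : MultiIndex n,
    HasDerivWithinAt (fun t => MvPowerSeries.coeff k (γ t)) (MvPowerSeries.coeff k (Φ δ))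
      (Set.Ici 0) δ

/-- `(Np, Nm, N0)`, standing for `(N^q, N^{-q}, N^0)`, is a solution on `[0, ∞)` in the space of
normal forms of the system
`∂_δ N^{±q} = -N^{±q} ⟨q,∂⟩N^0`, `∂_δ N^0 = -2 ⟨q,∂⟩(κ^{[q]} N^{-q} N^q) e^{-2 ω_q δ}`
with the initial values `(Np', Nm', N0')`. -/
structure IsSolution {n : ℕ} (ω : Fin n → ℝ) (q : Fin n → ℤ) (Np' Nm' N0' : FormalSeries n)
    (Np Nm N0 : ℝ → FormalSeries n) : Prop where
  normal : ∀ δ : ℝ, 0 ≤ δ →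
    Np δ ∈ normalForms n ∧ Nm δ ∈ normalForms n ∧ N0 δ ∈ normalForms n
  init_p : Np 0 = Np'
  init_m : Nm 0 = Nm'
  init_0 : N0 0 = N0'
  ode_p : SatisfiesODE Np (fun δ => -(Np δ * dirDeriv q (N0 δ)))
  ode_m : SatisfiesODE Nm (fun δ => -(Nm δ * dirDeriv q (N0 δ)))
  ode_0 : SatisfiesODE N0 (fun δ => ((-2 * Real.exp (-2 * freq ω q * δ) : ℝ) : ℂ) •
    dirDeriv q (kappaPow (fun j => (q j).natAbs) * Nm δ * Np δ))

end

end NormalizationFlow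

/-!
The equations for `N^{±q}` are linear with a common coefficient, so `N^{±q} = U N̂^{±q}` with a
common factor `U` solving `∂U = -U ⟨q, ∂⟩N⁰`, `U(0) = 1`, where `N⁰` is obtained from `U` by one
integration. The orders of the data make the resulting Picard operator raise the order of the
difference of two curves, hence it has a coefficientwise fixed point on the whole half-line.

Convergence is controlled by Cauchy majorants depending on time. The term of degree `d` of `U` may
grow like `e^{ct}` with `c = ω_q / 2`, and the reciprocal radius of convergence increases, but only
from `R` to `2R`, like `R (2 - e^{-ct})`. Then `e^{-2ω_q t} U²` and its derivatives decay like
`e^{-ct}`, and the derivative lost in `⟨q, ∂⟩` is recovered by integrating the loss of radius. For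
large `R`, that is after rescaling to small data, the Picard operator preserves these majorants.
They give `e^{-ω_q t} N^{±q} = O(e^{-ct})`, and `N⁰` moves by `O(e^{-ct})` after time `t`, so that
it converges.
-/

namespace NormalizationFlow

noncomputable section

open Finset Filter Topology MvPowerSeries
open scoped MvPowerSeries.WithPiTopology

section Euler

variable {σ R : Type*} [Semiring R]

/-- The Euler derivation `∑ⱼ xⱼ ∂/∂xⱼ`, which multiplies the homogeneous part of degree `d`
by `d`. -/
def euler (H : MvPowerSeries σ R) : MvPowerSeries σ R := fun k => k.degree • coeff k H

theorem coeff_euler (k : σ →₀ ℕ) (H : MvPowerSeries σ R) :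
    coeff k (euler H) = k.degree • coeff k H := rfl

theorem euler_mul (F G : MvPowerSeries σ R) : euler (F * G) = euler F * G + F * euler G := by
  classical
  ext k
  rw [map_add, coeff_euler, coeff_mul, coeff_mul, coeff_mul, smul_sum, ← sum_add_distrib]
  refine sum_congr rfl fun p hp => ?_
  rw [coeff_euler, coeff_euler, ← HasAntidiagonal.mem_antidiagonal.1 hp, map_add, add_smul,
    smul_mul_assoc, mul_smul_comm]

end Euler

section Order

variable {σ R : Type*}

theorem order_le_order_euler [Semiring R] (H : MvPowerSeries σ R) :
    H.order ≤ (euler H).order :=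
  le_order fun k hk => by rw [coeff_euler, coeff_of_lt_order hk, smul_zero]

section Mul

variable [Semiring R] {F G : MvPowerSeries σ R} {a b : ℕ∞}

theorem le_order_mul_of_le (hF : a ≤ F.order) (hG : b ≤ G.order) : a + b ≤ (F * G).order :=
  (add_le_add hF hG).trans le_order_mul

theorem le_order_mul_of_le_left (hF : a ≤ F.order) (G : MvPowerSeries σ R) :
    a ≤ (F * G).order := by
  simpa using le_order_mul_of_le hF (zero_le (a := G.order))

theorem le_order_mul_of_le_right (F : MvPowerSeries σ R) (hG : b ≤ G.order) :
    b ≤ (F * G).order := by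
  simpa using le_order_mul_of_le (zero_le (a := F.order)) hG

end Mul

section Sub

variable [Ring R] {F G : MvPowerSeries σ R}

theorem le_order_sub {m : ℕ∞} (hF : m ≤ F.order) (hG : m ≤ G.order) : m ≤ (F - G).order := by
  rw [sub_eq_add_neg]
  exact (le_min hF (by rwa [order_neg])).trans min_order_le_add

theorem coeff_eq_of_lt_order_sub {k : σ →₀ ℕ} (h : (k.degree : ℕ∞) < (F - G).order) :
    coeff k F = coeff k G :=
  sub_eq_zero.1 (by rw [← map_sub, coeff_of_lt_order h])

end Sub

end Order

section HomNorm

variable {σ R : Type*} [Fintype σ] [DecidableEq σ] [NormedRing R]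

theorem mem_finsuppAntidiag_univ {d : ℕ} {k : σ →₀ ℕ} :
    k ∈ univ.finsuppAntidiag d ↔ k.degree = d := by
  simp [mem_finsuppAntidiag, Finsupp.degree_eq_sum]

/-- The `ℓ¹` norm of the coefficients of the homogeneous part of degree `d`. -/
def homNorm (d : ℕ) (H : MvPowerSeries σ R) : ℝ := ∑ k ∈ univ.finsuppAntidiag d, ‖coeff k H‖

theorem homNorm_nonneg (d : ℕ) (H : MvPowerSeries σ R) : 0 ≤ homNorm d H :=
  sum_nonneg fun _ _ => norm_nonneg _

theorem norm_coeff_le_homNorm (H : MvPowerSeries σ R) (k : σ →₀ ℕ) :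
    ‖coeff k H‖ ≤ homNorm k.degree H :=
  single_le_sum (f := fun k => ‖coeff k H‖) (fun _ _ => norm_nonneg _)
    (mem_finsuppAntidiag_univ.2 rfl)

theorem homNorm_add_le (d : ℕ) (F G : MvPowerSeries σ R) :
    homNorm d (F + G) ≤ homNorm d F + homNorm d G := by
  rw [homNorm, homNorm, homNorm, ← sum_add_distrib]
  exact sum_le_sum fun k _ => by rw [map_add]; exact norm_add_le _ _

theorem homNorm_sub_le (d : ℕ) (F G : MvPowerSeries σ R) :
    homNorm d (F - G) ≤ homNorm d F + homNorm d G := by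
  rw [homNorm, homNorm, homNorm, ← sum_add_distrib]
  exact sum_le_sum fun k _ => by rw [map_sub]; exact norm_sub_le _ _

theorem homNorm_smul {𝕜 : Type*} [NormedField 𝕜] [NormedAlgebra 𝕜 R] (d : ℕ) (a : 𝕜)
    (H : MvPowerSeries σ R) : homNorm d (a • H) = ‖a‖ * homNorm d H := by
  rw [homNorm, homNorm, mul_sum]
  exact sum_congr rfl fun k _ => norm_smul a (coeff k H)

theorem homNorm_eq_zero_of_lt_order {d : ℕ} {H : MvPowerSeries σ R} (h : (d : ℕ∞) < H.order) :
    homNorm d H = 0 :=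
  sum_eq_zero fun k hk => by
    rw [coeff_of_lt_order (by rwa [mem_finsuppAntidiag_univ.1 hk]), norm_zero]

theorem homNorm_eq_of_lt_order_sub {d : ℕ} {F G : MvPowerSeries σ R}
    (h : (d : ℕ∞) < (F - G).order) : homNorm d F = homNorm d G :=
  sum_congr rfl fun k hk => by
    rw [coeff_eq_of_lt_order_sub (by rwa [mem_finsuppAntidiag_univ.1 hk])]

theorem homNorm_one_le [NormOneClass R] (d : ℕ) :
    homNorm d (1 : MvPowerSeries σ R) ≤ if d = 0 then 1 else 0 := by
  rcases eq_or_ne d 0 with rfl | hd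
  · simp [homNorm]
  · refine (sum_eq_zero fun k hk => ?_).trans_le (if_neg hd).ge
    have hk0 : k ≠ 0 := by
      rintro rfl
      exact hd (by simpa using (mem_finsuppAntidiag_univ.1 hk).symm)
    rw [coeff_one, if_neg hk0, norm_zero]

theorem homNorm_mul_le (d : ℕ) (F G : MvPowerSeries σ R) :
    homNorm d (F * G) ≤ ∑ p ∈ antidiagonal d, homNorm p.1 F * homNorm p.2 G := by
  calc homNorm d (F * G) ≤ ∑ k ∈ univ.finsuppAntidiag d, ∑ p ∈ antidiagonal k,
        ‖coeff p.1 F‖ * ‖coeff p.2 G‖ := by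
        refine sum_le_sum fun k _ => ?_
        rw [coeff_mul]
        exact norm_sum_le_of_le _ fun p _ => norm_mul_le _ _
    _ = ∑ p ∈ antidiagonal d, homNorm p.1 F * homNorm p.2 G := by
        simp only [homNorm, sum_mul_sum, ← sum_product']
        rw [sum_sigma', sum_sigma']
        refine sum_nbij' (fun x => ⟨(x.2.1.degree, x.2.2.degree), x.2⟩)
          (fun x => ⟨x.2.1 + x.2.2, x.2⟩) ?_ ?_ ?_ ?_ fun _ _ => rfl <;>
        · simp only [mem_sigma, mem_product, HasAntidiagonal.mem_antidiagonal,
            mem_finsuppAntidiag_univ]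
          grind

theorem homNorm_euler [NormedAlgebra ℝ R] (d : ℕ) (H : MvPowerSeries σ R) :
    homNorm d (euler H) = d * homNorm d H := by
  rw [homNorm, homNorm, mul_sum]
  refine sum_congr rfl fun k hk => ?_
  rw [coeff_euler, RCLike.norm_nsmul ℝ, nsmul_eq_mul, mem_finsuppAntidiag_univ.1 hk]

end HomNorm

section Weight

/-- The coefficients of a one-variable majorant with radius of convergence `S⁻¹`. The factor
`(d + 1)⁻²` makes the weights submultiplicative under convolution, the factor `8⁻¹` makes the
constant equal to one, see `sum_antidiagonal_weight_le`. -/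
def weight (S : ℝ) (d : ℕ) : ℝ := S ^ d / (8 * ((d : ℝ) + 1) ^ 2)

theorem weight_nonneg {S : ℝ} (hS : 0 ≤ S) (d : ℕ) : 0 ≤ weight S d := by
  unfold weight; positivity

theorem weight_mono {S T : ℝ} (hS : 0 ≤ S) (hST : S ≤ T) (d : ℕ) : weight S d ≤ weight T d := by
  unfold weight; gcongr

theorem weight_mul (S r : ℝ) (d : ℕ) : weight (S * r) d = weight S d * r ^ d := by
  rw [weight, weight, mul_pow]; ring

theorem weight_add_two_le {S : ℝ} (hS : 0 ≤ S) (d : ℕ) :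
    weight S (d + 2) ≤ S ^ 2 * weight S d := by
  rw [weight, weight, ← mul_div_assoc, ← pow_add, add_comm 2 d]
  gcongr
  simp

theorem sum_range_inv_succ_sq_le (m : ℕ) : ∑ i ∈ range m, ((i + 1 : ℝ) ^ 2)⁻¹ ≤ 2 := by
  have h := sum_Ioo_inv_sq_le (α := ℝ) 0 (m + 1)
  rw [← Ico_succ_left_eq_Ioo, sum_Ico_eq_sum_range] at h
  simpa [add_comm] using h

theorem sum_range_weight_one_le_one (m : ℕ) : ∑ d ∈ range m, weight 1 d ≤ 1 := by
  calc ∑ d ∈ range m, weight 1 d = 8⁻¹ * ∑ d ∈ range m, ((d + 1 : ℝ) ^ 2)⁻¹ := by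
        rw [mul_sum]
        exact sum_congr rfl fun d _ => by rw [weight, one_pow, one_div, mul_inv]
    _ ≤ 1 := by linarith [sum_range_inv_succ_sq_le m]

theorem sum_antidiagonal_inv_succ_sq_le (d : ℕ) :
    ∑ p ∈ antidiagonal d, (((p.1 + 1 : ℝ) ^ 2)⁻¹ + ((p.2 + 1 : ℝ) ^ 2)⁻¹) ≤ 4 := by
  have h1 := Nat.sum_antidiagonal_eq_sum_range_succ (fun i _ => ((i + 1 : ℝ) ^ 2)⁻¹) d
  have h2 := Nat.sum_antidiagonal_swap (n := d) (f := fun p => ((p.1 + 1 : ℝ) ^ 2)⁻¹)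
  simp only [Prod.fst_swap] at h2
  rw [sum_add_distrib, h2, h1]
  linarith [sum_range_inv_succ_sq_le d.succ]

theorem sum_antidiagonal_weight_le {S : ℝ} (hS : 0 ≤ S) (d : ℕ) :
    ∑ p ∈ antidiagonal d, weight S p.1 * weight S p.2 ≤ weight S d := by
  have hterm : ∀ p ∈ antidiagonal d, weight S p.1 * weight S p.2 ≤
      S ^ d / (32 * (d + 1) ^ 2) * (((p.1 + 1 : ℝ) ^ 2)⁻¹ + ((p.2 + 1 : ℝ) ^ 2)⁻¹) := by
    intro p hp
    obtain rfl := Finset.HasAntidiagonal.mem_antidiagonal.1 hp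
    have hsum : ((p.1 : ℝ) + p.2 + 1) ^ 2 ≤ 2 * ((p.1 + 1 : ℝ) ^ 2 + (p.2 + 1 : ℝ) ^ 2) := by
      nlinarith [sq_nonneg ((p.1 : ℝ) - p.2), p.1.cast_nonneg (α := ℝ), p.2.cast_nonneg (α := ℝ)]
    rw [weight, weight, pow_add]
    push_cast
    field_simp
    linarith [mul_le_mul_of_nonneg_left hsum (show 0 ≤ S ^ p.1 * S ^ p.2 by positivity)]
  calc ∑ p ∈ antidiagonal d, weight S p.1 * weight S p.2
      ≤ S ^ d / (32 * (d + 1) ^ 2) *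
          ∑ p ∈ antidiagonal d, (((p.1 + 1 : ℝ) ^ 2)⁻¹ + ((p.2 + 1 : ℝ) ^ 2)⁻¹) := by
        rw [mul_sum]; exact sum_le_sum hterm
    _ ≤ S ^ d / (32 * (d + 1) ^ 2) * 4 := by
        gcongr; exact sum_antidiagonal_inv_succ_sq_le d
    _ = weight S d := by rw [weight]; field_simp; ring

end Weight

section Majorized

variable {σ R : Type*} [Fintype σ] [DecidableEq σ] [NormedRing R] {F G H : MvPowerSeries σ R}
  {α β S T : ℝ}

/-- The homogeneous parts of `H` are dominated by `α` times the majorant with coefficients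
`weight S`. -/
def Majorized (α S : ℝ) (H : MvPowerSeries σ R) : Prop := ∀ d, homNorm d H ≤ α * weight S d

theorem Majorized.nonneg (h : Majorized α S H) : 0 ≤ α := by
  have h0 := (homNorm_nonneg 0 H).trans (h 0)
  simp only [weight, pow_zero] at h0
  exact nonneg_of_mul_nonneg_left h0 (by norm_num)

theorem Majorized.mono (h : Majorized α S H) (hαβ : α ≤ β) (hS : 0 ≤ S) (hST : S ≤ T) :
    Majorized β T H := fun d =>
  (h d).trans (mul_le_mul hαβ (weight_mono hS hST d) (weight_nonneg hS d) (h.nonneg.trans hαβ))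

theorem Majorized.add (hF : Majorized α S F) (hG : Majorized β S G) :
    Majorized (α + β) S (F + G) := fun d =>
  (homNorm_add_le d F G).trans (by rw [add_mul]; exact add_le_add (hF d) (hG d))

theorem Majorized.sub (hF : Majorized α S F) (hG : Majorized β S G) :
    Majorized (α + β) S (F - G) := fun d =>
  (homNorm_sub_le d F G).trans (by rw [add_mul]; exact add_le_add (hF d) (hG d))

theorem Majorized.smul {𝕜 : Type*} [NormedField 𝕜] [NormedAlgebra 𝕜 R] (hH : Majorized α S H)
    (a : 𝕜) : Majorized (‖a‖ * α) S (a • H) := fun d => by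
  rw [homNorm_smul, mul_assoc]
  exact mul_le_mul_of_nonneg_left (hH d) (norm_nonneg a)

theorem Majorized.mul (hF : Majorized α S F) (hG : Majorized β S G) (hS : 0 ≤ S) :
    Majorized (α * β) S (F * G) := fun d => by
  have hα := hF.nonneg
  have hβ := hG.nonneg
  calc homNorm d (F * G) ≤ ∑ p ∈ antidiagonal d, homNorm p.1 F * homNorm p.2 G :=
        homNorm_mul_le d F G
    _ ≤ ∑ p ∈ antidiagonal d, α * weight S p.1 * (β * weight S p.2) := by
        gcongr with p
        · exact homNorm_nonneg _ _
        · exact mul_nonneg hα (weight_nonneg hS _)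
        · exact hF _
        · exact hG _
    _ = α * β * ∑ p ∈ antidiagonal d, weight S p.1 * weight S p.2 := by
        rw [mul_sum]; exact sum_congr rfl fun p _ => by ring
    _ ≤ α * β * weight S d := by gcongr; exact sum_antidiagonal_weight_le hS d

theorem Majorized.sum_norm_coeff_mul_pow_le {ρ : ℝ} (hH : Majorized α S H) (hS : 0 ≤ S)
    (hρ : 0 ≤ ρ) (hSρ : S * ρ ≤ 1) (s : Finset (σ →₀ ℕ)) :
    ∑ k ∈ s, ‖coeff k H‖ * ρ ^ k.degree ≤ α := by
  have hα := hH.nonneg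
  have hfiber : ∀ d, ∑ k ∈ s with k.degree = d, ‖coeff k H‖ * ρ ^ k.degree ≤
      homNorm d H * ρ ^ d := fun d => by
    rw [homNorm, sum_mul, sum_congr rfl fun k hk => by rw [(mem_filter.1 hk).2]]
    exact sum_le_sum_of_subset_of_nonneg
      (fun k hk => mem_finsuppAntidiag_univ.2 (mem_filter.1 hk).2) fun _ _ _ => by positivity
  calc ∑ k ∈ s, ‖coeff k H‖ * ρ ^ k.degree
      = ∑ d ∈ range (s.sup Finsupp.degree + 1),
          ∑ k ∈ s with k.degree = d, ‖coeff k H‖ * ρ ^ k.degree :=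
        (sum_fiberwise_of_maps_to (fun k hk => mem_range_succ_iff.2 (le_sup hk)) _).symm
    _ ≤ ∑ d ∈ range (s.sup Finsupp.degree + 1), α * weight 1 d := by
        refine sum_le_sum fun d _ => (hfiber d).trans ?_
        calc homNorm d H * ρ ^ d ≤ α * weight S d * ρ ^ d := by gcongr; exact hH d
          _ = α * weight (S * ρ) d := by rw [weight_mul, mul_assoc]
          _ ≤ α * weight 1 d := by gcongr; exact weight_mono (by positivity) hSρ d
    _ ≤ α := by
        rw [← mul_sum]; exact mul_le_of_le_one_right hα (sum_range_weight_one_le_one _)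

end Majorized

section SupNorm

variable {n : ℕ} {H : FormalSeries n} {α S ρ : ℝ}

theorem norm_term_le (H : FormalSeries n) {z : Fin n ⊕ Fin n → ℂ} (hz : z ∈ polydisk n ρ)
    (k : MultiIndex n) : ‖term H z k‖ ≤ ‖coeff k H‖ * ρ ^ k.degree := by
  rw [term, norm_mul, Finsupp.prod, norm_prod, Finsupp.degree_apply, ← prod_pow_eq_pow_sum]
  gcongr with i _
  rw [norm_pow]
  gcongr
  exact (hz i).le

theorem Majorized.sum_norm_term_le (hH : Majorized α S H) (hS : 0 ≤ S) (hρ : 0 ≤ ρ)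
    (hSρ : S * ρ ≤ 1) {z : Fin n ⊕ Fin n → ℂ} (hz : z ∈ polydisk n ρ)
    (s : Finset (MultiIndex n)) : ∑ k ∈ s, ‖term H z k‖ ≤ α :=
  (sum_le_sum fun k _ => norm_term_le H hz k).trans (hH.sum_norm_coeff_mul_pow_le hS hρ hSρ s)

theorem Majorized.summable_norm_term (hH : Majorized α S H) (hS : 0 ≤ S) (hρ : 0 ≤ ρ)
    (hSρ : S * ρ ≤ 1) {z : Fin n ⊕ Fin n → ℂ} (hz : z ∈ polydisk n ρ) :
    Summable fun k => ‖term H z k‖ :=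
  summable_of_sum_le (fun _ => norm_nonneg _) (hH.sum_norm_term_le hS hρ hSρ hz)

theorem Majorized.norm_value_le (hH : Majorized α S H) (hS : 0 ≤ S) (hρ : 0 ≤ ρ)
    (hSρ : S * ρ ≤ 1) {z : Fin n ⊕ Fin n → ℂ} (hz : z ∈ polydisk n ρ) : ‖value H z‖ ≤ α :=
  (norm_tsum_le_tsum_norm (hH.summable_norm_term hS hρ hSρ hz)).trans
    ((hH.summable_norm_term hS hρ hSρ hz).tsum_le_of_sum_le (hH.sum_norm_term_le hS hρ hSρ hz))

theorem Majorized.mem_boundedAnalytic (hH : Majorized α S H) (hS : 0 ≤ S) (hρ : 0 ≤ ρ)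
    (hSρ : S * ρ ≤ 1) : H ∈ boundedAnalytic n ρ :=
  ⟨fun _ hz => (hH.summable_norm_term hS hρ hSρ hz).of_norm, α,
    Set.forall_mem_image.2 fun _ hz => hH.norm_value_le hS hρ hSρ hz⟩

theorem Majorized.supNorm_le (hH : Majorized α S H) (hS : 0 ≤ S) (hρ : 0 ≤ ρ)
    (hSρ : S * ρ ≤ 1) : supNorm ρ H ≤ α :=
  Real.sSup_le (Set.forall_mem_image.2 fun _ hz => hH.norm_value_le hS hρ hSρ hz) hH.nonneg

theorem supNorm_nonneg (ρ : ℝ) (H : FormalSeries n) : 0 ≤ supNorm ρ H :=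
  Real.sSup_nonneg (Set.forall_mem_image.2 fun _ _ => norm_nonneg _)

end SupNorm

section Majorized

variable {σ R : Type*} [Fintype σ] [DecidableEq σ] [NormedRing R] {H : MvPowerSeries σ R}
  {α S : ℝ}

theorem Majorized.euler [NormedAlgebra ℝ R] (h : Majorized α S H) :
    Majorized α (S * 2) (euler H) := fun d => by
  have hd : (d : ℝ) ≤ 2 ^ d := by exact_mod_cast Nat.lt_two_pow_self.le
  calc homNorm d (NormalizationFlow.euler H) = d * homNorm d H := homNorm_euler d H
    _ ≤ 2 ^ d * (α * weight S d) := mul_le_mul hd (h d) (homNorm_nonneg d H) (by positivity)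
    _ = α * weight (S * 2) d := by rw [weight_mul]; ring

theorem Majorized.eventually_of_lt_order {K : ℝ} {m : ℕ} (h : Majorized α S H) (hS : 0 < S)
    (hm : (m : ℕ∞) < H.order) (hK : 0 < K) : ∀ᶠ T in atTop, Majorized (K / T ^ m) T H := by
  filter_upwards [eventually_ge_atTop S, eventually_ge_atTop (α * S ^ (m + 1) / K)] with T hST hT d
  have hT0 : 0 < T := hS.trans_le hST
  rcases le_or_gt d m with hd | hd
  · rw [homNorm_eq_zero_of_lt_order ((Nat.cast_le.2 hd).trans_lt hm)]
    exact mul_nonneg (by positivity) (weight_nonneg hT0.le d)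
  · have hratio : S / T ≤ 1 := (div_le_one hT0).2 hST
    have hα := h.nonneg
    calc homNorm d H ≤ α * weight (T * (S / T)) d := by
          rw [mul_div_cancel₀ _ hT0.ne']; exact h d
      _ = α * (weight T d * (S / T) ^ d) := by rw [weight_mul]
      _ ≤ α * (weight T d * (S / T) ^ (m + 1)) := by
          have := weight_nonneg hT0.le d
          gcongr ?_ * (?_ * ?_)
          exact pow_le_pow_of_le_one (by positivity) hratio hd
      _ = α * S ^ (m + 1) / T / T ^ m * weight T d := by rw [div_pow, pow_succ T]; field_simp
      _ ≤ K / T ^ m * weight T d := by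
          gcongr
          · exact weight_nonneg hT0.le d
          · rwa [div_le_comm₀ hT0 hK]

theorem card_finsuppAntidiag_univ_le (d : ℕ) :
    #(univ.finsuppAntidiag d : Finset (σ →₀ ℕ)) ≤ 2 ^ (Fintype.card σ + d) := by
  rw [card_finsuppAntidiag_nat_eq_choose]
  exact (Nat.choose_le_two_pow _ _).trans (Nat.pow_le_pow_right two_pos (Nat.sub_le _ _))

theorem eventually_majorized_of_norm_coeff_le {c a : ℝ}
    (h : ∀ k, ‖coeff k H‖ ≤ c * Real.exp (a * k.degree)) :
    ∃ C, ∀ᶠ S in atTop, Majorized C S H := by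
  have hc : 0 ≤ c := by simpa using (norm_nonneg _).trans (h 0)
  refine ⟨8 * 2 ^ Fintype.card σ * c, (eventually_ge_atTop (8 * Real.exp a)).mono fun S hS d => ?_⟩
  have hS0 : 0 ≤ S := le_trans (by positivity) hS
  have hd : (d + 1 : ℝ) ^ 2 ≤ 4 ^ d := by
    have : (d + 1 : ℝ) ≤ 2 ^ d := by exact_mod_cast Nat.lt_two_pow_self
    calc (d + 1 : ℝ) ^ 2 ≤ (2 ^ d) ^ 2 := by gcongr
      _ = 4 ^ d := by rw [← pow_mul, mul_comm, pow_mul]; norm_num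
  calc homNorm d H ≤ #(univ.finsuppAntidiag d : Finset (σ →₀ ℕ)) • (c * Real.exp a ^ d) :=
        sum_le_card_nsmul _ _ _ fun k hk => (h k).trans_eq <| by
          rw [mem_finsuppAntidiag_univ.1 hk, mul_comm a, Real.exp_nat_mul]
    _ ≤ 2 ^ (Fintype.card σ + d) * (c * Real.exp a ^ d) := by
        rw [nsmul_eq_mul]; gcongr; exact_mod_cast card_finsuppAntidiag_univ_le d
    _ = 8 * 2 ^ Fintype.card σ * c * ((8 * Real.exp a) ^ d / (8 * 4 ^ d)) := by
        rw [show (8 : ℝ) * Real.exp a = 2 * Real.exp a * 4 by ring, mul_pow _ (4 : ℝ), pow_add,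
          mul_pow]
        field_simp
    _ ≤ 8 * 2 ^ Fintype.card σ * c * weight S d := by unfold weight; gcongr

theorem continuous_homNorm (d : ℕ) :
    Continuous (homNorm d : MvPowerSeries σ R → ℝ) :=
  continuous_finsetSum _ fun k _ => (WithPiTopology.continuous_coeff R k).norm

theorem exists_tendsto_of_majorized_sub [CompleteSpace R] {ι : Type*} [SemilatticeSup ι]
    {γ : ι → MvPowerSeries σ R} {g : ι → ℝ} {i₀ : ι} (hg : Tendsto g atTop (𝓝 0))
    (h : ∀ i j, i₀ ≤ i → i ≤ j → Majorized (g i) S (γ i - γ j)) :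
    ∃ L, Tendsto γ atTop (𝓝 L) ∧ ∀ i, i₀ ≤ i → Majorized (g i) S (γ i - L) := by
  have : Nonempty ι := ⟨i₀⟩
  have hcauchy : ∀ k, CauchySeq fun i => coeff k (γ i) := fun k => by
    refine Metric.cauchySeq_iff'.2 fun ε hε => ?_
    have hgw : Tendsto (fun i => g i * weight S k.degree) atTop (𝓝 0) := by
      simpa using hg.mul_const (weight S k.degree)
    obtain ⟨i, hi, hi₀⟩ := ((hgw.eventually_lt_const hε).and (eventually_ge_atTop i₀)).exists
    refine ⟨i, fun j hij => ?_⟩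
    rw [dist_comm, dist_eq_norm, ← map_sub]
    exact ((norm_coeff_le_homNorm _ k).trans (h i j hi₀ hij _)).trans_lt hi
  choose L hL using fun k => cauchySeq_tendsto_of_complete (hcauchy k)
  have hγ : Tendsto γ atTop (𝓝 (L : MvPowerSeries σ R)) :=
    WithPiTopology.tendsto_iff_coeff_tendsto _ _ _ |>.2 hL
  refine ⟨L, hγ, fun i hi d => ?_⟩
  exact le_of_tendsto (((continuous_homNorm d).tendsto _).comp (hγ.const_sub (γ i)))
    ((eventually_ge_atTop i).mono fun j hij => h i j hi hij d)

end Majorized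

section NormalForms

variable {n : ℕ} {F G N : FormalSeries n}

theorem mem_normalForms_iff : N ∈ normalForms n ↔
    ∀ k : MultiIndex n, (∃ j, k (Sum.inl j) ≠ k (Sum.inr j)) → coeff k N = 0 :=
  forall_congr' fun k => by rw [← not_imp_not, not_not, not_forall]

/-- The normal forms as a subalgebra of the formal power series. -/
def normalFormSubalgebra (n : ℕ) : Subalgebra ℂ (FormalSeries n) where
  carrier := normalForms n
  mul_mem' {F G} hF hG k hk j := by
    classical
    rw [coeff_mul] at hk
    obtain ⟨p, hp, hne⟩ := exists_ne_zero_of_sum_ne_zero hk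
    rw [← HasAntidiagonal.mem_antidiagonal.1 hp, Finsupp.add_apply, Finsupp.add_apply,
      hF _ (left_ne_zero_of_mul hne) j, hG _ (right_ne_zero_of_mul hne) j]
  add_mem' {F G} hF hG := mem_normalForms_iff.2 fun k hk => by
    rw [map_add, mem_normalForms_iff.1 hF k hk, mem_normalForms_iff.1 hG k hk, add_zero]
  algebraMap_mem' a k hk j := by
    classical
    have hk0 : k = 0 := by
      by_contra h
      exact hk (by rw [MvPowerSeries.algebraMap_apply, coeff_C, if_neg h])
    simp [hk0]

theorem isClosed_normalForms (n : ℕ) : IsClosed (normalForms n) := by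
  have h : normalForms n = ⋂ (k : MultiIndex n) (_ : ∃ j, k (Sum.inl j) ≠ k (Sum.inr j)),
      {N | coeff k N = 0} := by
    ext N; simp only [mem_normalForms_iff, Set.mem_iInter, Set.mem_ofPred_eq]
  rw [h]
  exact isClosed_biInter fun k _ =>
    isClosed_eq (WithPiTopology.continuous_coeff ℂ k) continuous_const

theorem monomial_diag_mem_normalForms (l : Fin n → ℕ) (a : ℂ) :
    monomial (diag l) a ∈ normalForms n := by
  classical
  intro k hk j
  have hkl : k = diag l := by
    by_contra h
    exact hk (by rw [coeff_monomial, if_neg h])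
  simp [hkl, diag]

theorem kappaPow_mul_mul_mem_normalForms (l : Fin n → ℕ) (hF : F ∈ normalForms n)
    (hG : G ∈ normalForms n) : kappaPow l * F * G ∈ normalForms n :=
  (normalFormSubalgebra n).mul_mem
    ((normalFormSubalgebra n).mul_mem (monomial_diag_mem_normalForms l 1) hF) hG

theorem degree_diag (l : Fin n → ℕ) : (diag l).degree = 2 * ∑ j, l j := by
  simp [diag, Finsupp.degree_eq_sum, two_mul]

theorem degree_diag_single (j : Fin n) : (diag (Pi.single j 1 : Fin n → ℕ)).degree = 2 := by
  simp [degree_diag]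

theorem IsOrderKappa.le_order {m : ℕ} (h : IsOrderKappa m N) (hN : N ∈ normalForms n) :
    ((2 * m : ℕ) : ℕ∞) ≤ N.order := by
  refine nat_le_order fun k hk => ?_
  by_contra h0
  have hdiag : k = diag fun j => k (Sum.inl j) := by
    ext (j | j)
    · rfl
    · exact (hN k h0 j).symm
  rw [hdiag, degree_diag] at hk
  exact h0 (hdiag ▸ h _ (by lia))

theorem isOrderKappa_of_le_order {m : ℕ} (h : ((2 * m : ℕ) : ℕ∞) ≤ N.order) : IsOrderKappa m N :=
  fun l hl => coeff_of_lt_order ((Nat.cast_lt.2 (by rw [degree_diag]; lia)).trans_le h)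

theorem harmonicMonomial_mul_harmonicMonomial_neg (q : Fin n → ℤ) :
    harmonicMonomial q * harmonicMonomial (-q) = kappaPow fun j => (q j).natAbs := by
  have h : minIndex q + minIndex (-q) = diag fun j => (q j).natAbs := by
    ext (j | j)
    · change (-q j).toNat + (- -q j).toNat = (q j).natAbs
      lia
    · change (q j).toNat + (-q j).toNat = (q j).natAbs
      lia
  rw [harmonicMonomial, harmonicMonomial, monomial_mul_monomial, kappaPow, mul_one, h]

theorem isOrderKappa_kappaPow_mul_mul {q : Fin n → ℤ} {m : ℕ}
    (hF : IsOrder m (harmonicMonomial q * F)) (hG : IsOrder m (harmonicMonomial (-q) * G)) :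
    IsOrderKappa m ((kappaPow fun j => (q j).natAbs) * G * F) := by
  refine isOrderKappa_of_le_order ?_
  calc ((2 * m : ℕ) : ℕ∞) = m + m := by norm_cast; lia
    _ ≤ (harmonicMonomial q * F).order + (harmonicMonomial (-q) * G).order :=
        add_le_add (nat_le_order hF) (nat_le_order hG)
    _ ≤ (harmonicMonomial q * F * (harmonicMonomial (-q) * G)).order := le_order_mul
    _ = ((kappaPow fun j => (q j).natAbs) * G * F).order := by
        rw [← harmonicMonomial_mul_harmonicMonomial_neg]; ring_nf

theorem eventually_majorized_of_mem_analyticSeries (h : N ∈ analyticSeries n) :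
    ∃ C, ∀ᶠ S in atTop, Majorized C S N :=
  let ⟨_, _, h⟩ := h
  eventually_majorized_of_norm_coeff_le h

theorem kappaPow_mem_analyticSeries (l : Fin n → ℕ) : kappaPow l ∈ analyticSeries n := by
  classical
  refine ⟨1, 0, fun k => ?_⟩
  rw [kappaPow, coeff_monomial]
  split_ifs <;> simp

theorem eventually_majorized_kappaPow_mul_mul (l : Fin n → ℕ) (hF : F ∈ analyticSeries n)
    (hG : G ∈ analyticSeries n) : ∃ C, ∀ᶠ S in atTop, Majorized C S (kappaPow l * F * G) := by
  obtain ⟨A, hA⟩ := eventually_majorized_of_mem_analyticSeries (kappaPow_mem_analyticSeries l)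
  obtain ⟨B, hB⟩ := eventually_majorized_of_mem_analyticSeries hF
  obtain ⟨C, hC⟩ := eventually_majorized_of_mem_analyticSeries hG
  refine ⟨A * B * C, ?_⟩
  filter_upwards [hA, hB, hC, eventually_ge_atTop 0] with S hA hB hC hS
  exact (hA.mul hB hS).mul hC hS

end NormalForms

section DirDeriv

variable {n : ℕ} {N : FormalSeries n} {α S : ℝ}

/-- The `ℓ¹` norm `∑ⱼ |qⱼ|`, the constant in the bounds for `dirDeriv q`. -/
def oneNorm (q : Fin n → ℤ) : ℝ := ∑ j, |(q j : ℝ)|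

theorem oneNorm_nonneg (q : Fin n → ℤ) : 0 ≤ oneNorm q := sum_nonneg fun _ _ => abs_nonneg _

theorem oneNorm_pos {q : Fin n → ℤ} (hq : q ≠ 0) : 0 < oneNorm q := by
  obtain ⟨j, hj⟩ := Function.ne_iff.1 hq
  exact sum_pos' (fun _ _ => abs_nonneg _) ⟨j, mem_univ j, abs_pos.2 (Int.cast_ne_zero.2 hj)⟩

theorem coeff_kappaDeriv (j : Fin n) (N : FormalSeries n) (k : MultiIndex n) :
    coeff k (kappaDeriv j N) =
      ((k (Sum.inl j) : ℂ) + 1) * coeff (k + diag (Pi.single j 1)) N := rfl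

theorem coeff_dirDeriv (q : Fin n → ℤ) (N : FormalSeries n) (k : MultiIndex n) :
    coeff k (dirDeriv q N) = ∑ j, (q j : ℂ) *
      (((k (Sum.inl j) : ℂ) + 1) * coeff (k + diag (Pi.single j 1)) N) := by
  simp only [dirDeriv, map_sum, map_smul, smul_eq_mul, coeff_kappaDeriv]

theorem dirDeriv_sub (q : Fin n → ℤ) (F G : FormalSeries n) :
    dirDeriv q (F - G) = dirDeriv q F - dirDeriv q G := by
  ext k
  simp only [coeff_dirDeriv, map_sub, mul_sub, sum_sub_distrib]

theorem continuous_dirDeriv (q : Fin n → ℤ) : Continuous (dirDeriv q) :=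
  continuous_pi fun k => (continuous_finsetSum univ fun _ _ => continuous_const.mul
    (continuous_const.mul (WithPiTopology.continuous_coeff ℂ _))).congr
      fun N => (coeff_dirDeriv q N k).symm

theorem dirDeriv_mem_normalForms (q : Fin n → ℤ) (hN : N ∈ normalForms n) :
    dirDeriv q N ∈ normalForms n := fun k hk j => by
  rw [coeff_dirDeriv] at hk
  obtain ⟨i, -, hi⟩ := exists_ne_zero_of_sum_ne_zero hk
  have hij := hN _ (right_ne_zero_of_mul (right_ne_zero_of_mul hi)) j
  simpa [diag] using hij

theorem le_order_dirDeriv (q : Fin n → ℤ) {m : ℕ∞} (h : m + 2 ≤ N.order) :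
    m ≤ (dirDeriv q N).order := by
  refine le_order fun k hk => ?_
  rw [coeff_dirDeriv]
  refine sum_eq_zero fun j _ => ?_
  have hdeg : ((k + diag (Pi.single j 1)).degree : ℕ∞) < N.order := by
    rw [map_add, degree_diag_single, Nat.cast_add]
    exact ((ENat.add_lt_add_iff_right (by simp)).2 hk).trans_le h
  rw [coeff_of_lt_order hdeg, mul_zero, mul_zero]

theorem norm_coeff_kappaDeriv_le (j : Fin n) (N : FormalSeries n) (k : MultiIndex n) :
    ‖coeff k (kappaDeriv j N)‖ ≤ ‖coeff (k + diag (Pi.single j 1)) (euler N)‖ := by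
  have hdeg : k (Sum.inl j) + 1 ≤ (k + diag (Pi.single j 1)).degree := by
    rw [map_add, degree_diag_single]
    linarith [Finsupp.le_degree (Sum.inl j) k]
  rw [coeff_kappaDeriv, coeff_euler, RCLike.norm_nsmul ℂ, nsmul_eq_mul, norm_mul,
    ← Nat.cast_succ, Complex.norm_natCast]
  gcongr

theorem homNorm_kappaDeriv_le (d : ℕ) (j : Fin n) (N : FormalSeries n) :
    homNorm d (kappaDeriv j N) ≤ homNorm (d + 2) (euler N) := by
  have hmap : (univ.finsuppAntidiag d).map (addRightEmbedding (diag (Pi.single j 1))) ⊆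
      univ.finsuppAntidiag (d + 2) := by
    intro k hk
    obtain ⟨l, hl, rfl⟩ := mem_map.1 hk
    rw [mem_finsuppAntidiag_univ] at hl ⊢
    rw [addRightEmbedding_apply, map_add, degree_diag_single, hl]
  calc homNorm d (kappaDeriv j N)
      ≤ ∑ k ∈ univ.finsuppAntidiag d, ‖coeff (k + diag (Pi.single j 1)) (euler N)‖ :=
        sum_le_sum fun k _ => norm_coeff_kappaDeriv_le j N k
    _ = ∑ k ∈ (univ.finsuppAntidiag d).map (addRightEmbedding (diag (Pi.single j 1))),
          ‖coeff k (euler N)‖ := by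
        simp only [sum_map, addRightEmbedding_apply]
    _ ≤ homNorm (d + 2) (euler N) :=
        sum_le_sum_of_subset_of_nonneg hmap fun _ _ _ => norm_nonneg _

theorem homNorm_dirDeriv_le (d : ℕ) (q : Fin n → ℤ) (N : FormalSeries n) :
    homNorm d (dirDeriv q N) ≤ oneNorm q * homNorm (d + 2) (euler N) := by
  calc homNorm d (dirDeriv q N) ≤ ∑ j, homNorm d ((q j : ℂ) • kappaDeriv j N) :=
        le_sum_of_subadditive _ (by simp [homNorm]) (homNorm_add_le d) _ _
    _ ≤ ∑ j, |(q j : ℝ)| * homNorm (d + 2) (euler N) := by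
        refine sum_le_sum fun j _ => ?_
        rw [homNorm_smul, Complex.norm_intCast]
        gcongr
        exact homNorm_kappaDeriv_le d j N
    _ = oneNorm q * homNorm (d + 2) (euler N) := (sum_mul _ _ _).symm

theorem Majorized.dirDeriv (q : Fin n → ℤ) (h : Majorized α S (NormalizationFlow.euler N))
    (hS : 0 ≤ S) : Majorized (oneNorm q * α * S ^ 2) S (dirDeriv q N) := fun d => by
  have hq := oneNorm_nonneg q
  have hα := h.nonneg
  calc homNorm d (NormalizationFlow.dirDeriv q N)
      ≤ oneNorm q * homNorm (d + 2) (NormalizationFlow.euler N) := homNorm_dirDeriv_le d q N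
    _ ≤ oneNorm q * (α * (S ^ 2 * weight S d)) := by
        gcongr
        exact (h _).trans (mul_le_mul_of_nonneg_left (weight_add_two_le hS d) hα)
    _ = oneNorm q * α * S ^ 2 * weight S d := by ring

end DirDeriv

section Primitive

variable {σ R : Type*} [NormedRing R] [NormedAlgebra ℝ R] {γ η : ℝ → MvPowerSeries σ R}

/-- The coefficientwise primitive of a curve of power series, vanishing at `0`. -/
def primitive (γ : ℝ → MvPowerSeries σ R) (t : ℝ) : MvPowerSeries σ R :=
  fun k => ∫ s in (0 : ℝ)..t, coeff k (γ s)

theorem coeff_primitive (γ : ℝ → MvPowerSeries σ R) (t : ℝ) (k : σ →₀ ℕ) :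
    coeff k (primitive γ t) = ∫ s in (0 : ℝ)..t, coeff k (γ s) := rfl

theorem primitive_zero (γ : ℝ → MvPowerSeries σ R) : primitive γ 0 = 0 := by
  ext k
  rw [coeff_primitive, intervalIntegral.integral_same, coeff_zero]

theorem coeff_primitive_congr {k : σ →₀ ℕ} (h : ∀ s, coeff k (γ s) = coeff k (η s)) (t : ℝ) :
    coeff k (primitive γ t) = coeff k (primitive η t) := by
  simp only [coeff_primitive, h]

theorem coeff_primitive_eq_zero {k : σ →₀ ℕ} (h : ∀ s, coeff k (γ s) = 0) (t : ℝ) :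
    coeff k (primitive γ t) = 0 := by
  simp only [coeff_primitive, h, intervalIntegral.integral_zero]

theorem le_order_primitive {m : ℕ∞} (h : ∀ s, m ≤ (γ s).order) (t : ℝ) :
    m ≤ (primitive γ t).order :=
  le_order fun _ hk => coeff_primitive_eq_zero (fun s => coeff_of_lt_order (hk.trans_le (h s))) t

theorem le_order_primitive_sub {m : ℕ∞} (h : ∀ s, m ≤ (γ s - η s).order) (t : ℝ) :
    m ≤ (primitive γ t - primitive η t).order :=
  le_order fun k hk => by
    rw [map_sub, sub_eq_zero]
    exact coeff_primitive_congr (fun s => coeff_eq_of_lt_order_sub (hk.trans_le (h s))) t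

theorem primitive_mem_normalForms {n : ℕ} {γ : ℝ → FormalSeries n}
    (hγ : ∀ t, γ t ∈ normalForms n) (t : ℝ) : primitive γ t ∈ normalForms n :=
  mem_normalForms_iff.2 fun k hk =>
    coeff_primitive_eq_zero (fun s => mem_normalForms_iff.1 (hγ s) k hk) t

theorem homNorm_primitive_sub_le [Fintype σ] [DecidableEq σ] (hγ : Continuous γ) {d : ℕ}
    {g g' : ℝ → ℝ} {a t : ℝ} (hat : a ≤ t) (hg : ∀ s, a ≤ s → HasDerivAt g (g' s) s)
    (h : ∀ s, a ≤ s → homNorm d (γ s) ≤ g' s) :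
    homNorm d (primitive γ t - primitive γ a) ≤ g t - g a := by
  have hcoeff : ∀ k, Continuous fun s => coeff k (γ s) := fun k =>
    (WithPiTopology.continuous_coeff R k).comp hγ
  calc homNorm d (primitive γ t - primitive γ a)
      ≤ ∑ k ∈ univ.finsuppAntidiag d, ∫ s in a..t, ‖coeff k (γ s)‖ := by
        refine sum_le_sum fun k _ => ?_
        rw [map_sub, coeff_primitive, coeff_primitive, intervalIntegral.integral_interval_sub_left
          ((hcoeff k).intervalIntegrable _ _) ((hcoeff k).intervalIntegrable _ _)]
        exact intervalIntegral.norm_integral_le_integral_norm hat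
    _ = ∫ s in a..t, homNorm d (γ s) :=
        (intervalIntegral.integral_finsetSum fun k _ =>
          (hcoeff k).norm.intervalIntegrable _ _).symm
    _ ≤ g t - g a := intervalIntegral.integral_le_sub_of_hasDeriv_right_of_le hat
        (fun s hs => (hg s hs.1).continuousAt.continuousWithinAt)
        (fun s hs => (hg s hs.1.le).hasDerivWithinAt)
        ((continuous_homNorm d).comp hγ).integrableOn_Icc fun s hs => h s hs.1.le

variable [CompleteSpace R]

theorem hasDerivAt_coeff_primitive (hγ : Continuous γ) (k : σ →₀ ℕ) (t : ℝ) :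
    HasDerivAt (fun t => coeff k (primitive γ t)) (coeff k (γ t)) t :=
  ((WithPiTopology.continuous_coeff R k).comp hγ).integral_hasStrictDerivAt 0 t |>.hasDerivAt

theorem continuous_primitive (hγ : Continuous γ) : Continuous (primitive γ) :=
  continuous_pi fun k => continuous_iff_continuousAt.2 fun t =>
    (hasDerivAt_coeff_primitive hγ k t).continuousAt

end Primitive

section FixedPoint

variable {σ R T : Type*} [Ring R]

theorem le_order_iterate_sub_iterate
    {Φ : (T → MvPowerSeries σ R) → T → MvPowerSeries σ R}
    (hΦ : ∀ (d : ℕ) U V, (∀ t, (d : ℕ∞) ≤ (U t - V t).order) →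
      ∀ t, (d : ℕ∞) + 1 ≤ (Φ U t - Φ V t).order)
    (U : T → MvPowerSeries σ R) {i j : ℕ} (hij : i ≤ j) (t : T) :
    (i : ℕ∞) ≤ (Φ^[j] U t - Φ^[i] U t).order := by
  induction i generalizing j t with
  | zero => simp
  | succ i ih =>
    obtain ⟨j, rfl⟩ := Nat.exists_eq_succ_of_ne_zero (Nat.ne_zero_of_lt hij)
    rw [Function.iterate_succ_apply', Function.iterate_succ_apply', Nat.cast_succ]
    exact hΦ i _ _ (ih (Nat.le_of_succ_le_succ hij)) t

theorem exists_fixedPoint_of_le_order_sub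
    {Φ : (T → MvPowerSeries σ R) → T → MvPowerSeries σ R} {s : Set (T → MvPowerSeries σ R)}
    (hΦ : ∀ (d : ℕ) U V, (∀ t, (d : ℕ∞) ≤ (U t - V t).order) →
      ∀ t, (d : ℕ∞) + 1 ≤ (Φ U t - Φ V t).order)
    (hne : s.Nonempty) (hmaps : Set.MapsTo Φ s s)
    (hclosed : ∀ U, (∀ d : ℕ, ∃ V ∈ s, ∀ t, (d : ℕ∞) ≤ (U t - V t).order) → U ∈ s) :
    ∃ U ∈ s, Φ U = U := by
  obtain ⟨U₀, hU₀⟩ := hne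
  let U : T → MvPowerSeries σ R := fun t k => coeff k (Φ^[k.degree + 1] U₀ t)
  have happrox : ∀ (d : ℕ) t, (d : ℕ∞) ≤ (U t - Φ^[d] U₀ t).order := fun d t =>
    nat_le_order fun k hk => by
      rw [map_sub, sub_eq_zero]
      exact (coeff_eq_of_lt_order_sub ((Nat.cast_lt.2 k.degree.lt_succ_self).trans_le
        (le_order_iterate_sub_iterate hΦ U₀ (Nat.succ_le_of_lt hk) t))).symm
  have hfix : ∀ t, ⊤ ≤ (Φ U t - U t).order := fun t => by
    refine ENat.forall_natCast_le_iff_le.1 fun d _ => ?_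
    have hstep := hΦ d _ _ (happrox d) t
    rw [← Function.iterate_succ_apply' Φ] at hstep
    rw [← sub_sub_sub_cancel_right _ _ (Φ^[d + 1] U₀ t)]
    exact le_order_sub (le_self_add.trans hstep)
      ((Nat.cast_le.2 d.le_succ).trans (happrox (d + 1) t))
  refine ⟨U, hclosed U fun d => ⟨Φ^[d] U₀, hmaps.iterate d hU₀, happrox d⟩, ?_⟩
  exact funext fun t => sub_eq_zero.1 (order_eq_top_iff.1 (top_le_iff.1 (hfix t)))

end FixedPoint

section Picard

variable {n : ℕ} {U V : ℝ → FormalSeries n}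

/-- The rate of decrease of `N⁰` along `N^{±q} = U N̂^{±q}`, where `P` stands for
`κ^{[q]} N̂^{-q} N̂^q` and `w` for `ω_q`. -/
def averageRate (w : ℝ) (q : Fin n → ℤ) (P : FormalSeries n) (U : ℝ → FormalSeries n) (t : ℝ) :
    FormalSeries n :=
  ((2 * Real.exp (-2 * w * t) : ℝ) : ℂ) • dirDeriv q (P * U t * U t)

/-- The component `N⁰` with initial value `M` that belongs to `N^{±q} = U N̂^{±q}`. -/
def averagePart (w : ℝ) (q : Fin n → ℤ) (P M : FormalSeries n) (U : ℝ → FormalSeries n) (t : ℝ) :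
    FormalSeries n :=
  M - primitive (averageRate w q P U) t

/-- The Picard operator of the equation `∂U = -U ⟨q, ∂⟩N⁰`, `U(0) = 1`, for the common factor `U`
of `N^{±q} = U N̂^{±q}`. -/
def picard (w : ℝ) (q : Fin n → ℤ) (P M : FormalSeries n) (U : ℝ → FormalSeries n) (t : ℝ) :
    FormalSeries n :=
  1 - primitive (fun s => U s * dirDeriv q (averagePart w q P M U s)) t

variable (w : ℝ) (q : Fin n → ℤ) {P : FormalSeries n} (M : FormalSeries n)

theorem averagePart_zero (P : FormalSeries n) (U : ℝ → FormalSeries n) :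
    averagePart w q P M U 0 = M := by
  rw [averagePart, primitive_zero, sub_zero]

theorem picard_zero (P : FormalSeries n) (U : ℝ → FormalSeries n) : picard w q P M U 0 = 1 := by
  rw [picard, primitive_zero, sub_zero]

theorem continuous_averageRate (hU : Continuous U) : Continuous (averageRate w q P U) :=
  .smul (f := fun t => ((2 * Real.exp (-2 * w * t) : ℝ) : ℂ)) (by fun_prop)
    ((continuous_dirDeriv q).comp ((continuous_const.mul hU).mul hU))

theorem continuous_averagePart (hU : Continuous U) : Continuous (averagePart w q P M U) :=
  continuous_const.sub (continuous_primitive (continuous_averageRate w q hU))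

theorem continuous_mul_dirDeriv_averagePart (hU : Continuous U) :
    Continuous fun t => U t * dirDeriv q (averagePart w q P M U t) :=
  hU.mul ((continuous_dirDeriv q).comp (continuous_averagePart w q M hU))

theorem continuous_picard (hU : Continuous U) : Continuous (picard w q P M U) :=
  continuous_const.sub (continuous_primitive (continuous_mul_dirDeriv_averagePart w q M hU))

theorem averageRate_mem_normalForms (hP : P ∈ normalForms n) (hU : ∀ t, U t ∈ normalForms n)
    (t : ℝ) : averageRate w q P U t ∈ normalForms n :=
  (normalFormSubalgebra n).smul_mem (dirDeriv_mem_normalForms q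
    ((normalFormSubalgebra n).mul_mem ((normalFormSubalgebra n).mul_mem hP (hU t)) (hU t))) _

theorem averagePart_mem_normalForms {M : FormalSeries n} (hP : P ∈ normalForms n)
    (hM : M ∈ normalForms n) (hU : ∀ t, U t ∈ normalForms n) (t : ℝ) :
    averagePart w q P M U t ∈ normalForms n :=
  (normalFormSubalgebra n).sub_mem hM
    (primitive_mem_normalForms (averageRate_mem_normalForms w q hP hU) t)

theorem picard_mem_normalForms {M : FormalSeries n} (hP : P ∈ normalForms n)
    (hM : M ∈ normalForms n) (hU : ∀ t, U t ∈ normalForms n) (t : ℝ) :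
    picard w q P M U t ∈ normalForms n :=
  (normalFormSubalgebra n).sub_mem (normalFormSubalgebra n).one_mem <|
    primitive_mem_normalForms (fun s => (normalFormSubalgebra n).mul_mem (hU s)
      (dirDeriv_mem_normalForms q (averagePart_mem_normalForms w q hP hM hU s))) t

theorem le_order_averagePart {M : FormalSeries n} (hP : 5 ≤ P.order) (hM : 3 ≤ M.order)
    (U : ℝ → FormalSeries n) (t : ℝ) : 3 ≤ (averagePart w q P M U t).order :=
  le_order_sub hM <| le_order_primitive (fun s => (le_order_dirDeriv q (by
    norm_num
    exact le_order_mul_of_le_left (le_order_mul_of_le_left hP _) _)).trans le_order_smul) t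

theorem le_order_averagePart_sub (hP : 5 ≤ P.order) {m : ℕ∞} (h : ∀ t, m ≤ (U t - V t).order)
    (t : ℝ) : m + 3 ≤ (averagePart w q P M U t - averagePart w q P M V t).order := by
  rw [averagePart, averagePart, sub_sub_sub_cancel_left]
  refine le_order_primitive_sub (fun s => ?_) t
  have hdiff : averageRate w q P V s - averageRate w q P U s =
      ((2 * Real.exp (-2 * w * s) : ℝ) : ℂ) • dirDeriv q (P * (U s - V s) * (-(U s) - V s)) := by
    rw [averageRate, averageRate, ← smul_sub, ← dirDeriv_sub]
    ring_nf
  rw [hdiff]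
  refine (le_order_dirDeriv q ?_).trans le_order_smul
  calc m + 3 + 2 = 5 + m := by ring
    _ ≤ (P * (U s - V s) * (-(U s) - V s)).order :=
        le_order_mul_of_le_left (le_order_mul_of_le hP (h s)) _

theorem le_order_picard_sub {M : FormalSeries n} (hP : 5 ≤ P.order) (hM : 3 ≤ M.order) {m : ℕ∞}
    (h : ∀ t, m ≤ (U t - V t).order) (t : ℝ) :
    m + 1 ≤ (picard w q P M U t - picard w q P M V t).order := by
  rw [picard, picard, sub_sub_sub_cancel_left]
  refine le_order_primitive_sub (fun s => ?_) t
  have hdiff : V s * dirDeriv q (averagePart w q P M V s) -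
      U s * dirDeriv q (averagePart w q P M U s) =
      -U s * dirDeriv q (averagePart w q P M U s - averagePart w q P M V s) -
        (U s - V s) * dirDeriv q (averagePart w q P M V s) := by
    rw [dirDeriv_sub]
    ring
  have havg : m + 1 + 2 ≤ (averagePart w q P M U s - averagePart w q P M V s).order :=
    (show m + 1 + 2 = m + 3 by ring).trans_le (le_order_averagePart_sub w q M hP h s)
  rw [hdiff]
  exact le_order_sub (le_order_mul_of_le_right _ (le_order_dirDeriv q havg))
    (le_order_mul_of_le (h s) (le_order_dirDeriv q (le_order_averagePart w q hP hM V s)))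

end Picard

section TimeDependentMajorants

variable {c t R : ℝ}

/-- The factor by which the reciprocal radius of convergence of the majorants has grown at
time `t`. It stays below `2`, so that the radius of convergence never degenerates. -/
def dilation (c t : ℝ) : ℝ := 2 - Real.exp (-(c * t))

theorem one_le_dilation (hc : 0 ≤ c) (ht : 0 ≤ t) : 1 ≤ dilation c t := by
  have : Real.exp (-(c * t)) ≤ 1 := Real.exp_le_one_iff.2 (neg_nonpos.2 (mul_nonneg hc ht))
  unfold dilation; linarith

theorem dilation_le_two (c t : ℝ) : dilation c t ≤ 2 := by
  unfold dilation; linarith [Real.exp_pos (-(c * t))]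

theorem dilation_zero (c : ℝ) : dilation c 0 = 1 := by norm_num [dilation]

theorem hasDerivAt_exp_mul (c t : ℝ) :
    HasDerivAt (fun t => Real.exp (c * t)) (c * Real.exp (c * t)) t := by
  simpa [mul_comm c (Real.exp _)] using ((hasDerivAt_id t).const_mul c).exp

theorem hasDerivAt_dilation (c t : ℝ) :
    HasDerivAt (dilation c) (c * Real.exp (-(c * t))) t := by
  refine (((hasDerivAt_exp_mul (-c) t).const_sub 2).congr_deriv (by simp)).congr_of_eventuallyEq
    (.of_eq (funext fun s => ?_))
  rw [dilation, neg_mul]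

/-- The part of the majorant of `U` that does not come from the shrinking radius of convergence.
The denominator lets the degree of a term compensate the growth in time: the factor itself is at
most `e^{ct}`, and `d` times it is at most `e^{2ct}`. -/
def growthFactor (c : ℝ) (d : ℕ) (t : ℝ) : ℝ := Real.exp (c * t) ^ 2 / (Real.exp (c * t) + d)

theorem growthFactor_nonneg (c : ℝ) (d : ℕ) (t : ℝ) : 0 ≤ growthFactor c d t := by
  unfold growthFactor; positivity

theorem growthFactor_le (c : ℝ) (d : ℕ) (t : ℝ) : growthFactor c d t ≤ Real.exp (c * t) := by
  rw [growthFactor, div_le_iff₀ (by positivity), sq]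
  gcongr
  simp

theorem mul_growthFactor_le (c : ℝ) (d : ℕ) (t : ℝ) :
    d * growthFactor c d t ≤ Real.exp (c * t) ^ 2 := by
  rw [growthFactor, mul_div_assoc', div_le_iff₀ (by positivity), mul_comm]
  gcongr
  simp [Real.exp_nonneg]

theorem hasDerivAt_growthFactor (c : ℝ) (d : ℕ) (t : ℝ) :
    HasDerivAt (growthFactor c d)
      (c * growthFactor c d t * (1 + d / (Real.exp (c * t) + d))) t := by
  have hE := hasDerivAt_exp_mul c t
  have hpos : 0 < Real.exp (c * t) + d := by positivity
  refine ((hE.pow 2).div (hE.add_const (d : ℝ)) hpos.ne').congr_deriv ?_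
  simp only [growthFactor, Pi.pow_apply]
  field_simp
  ring

/-- The majorant of the homogeneous part of degree `d` of the common factor `U`. -/
def multiplierMajorant (R c : ℝ) (d : ℕ) (t : ℝ) : ℝ :=
  8 * growthFactor c d t * weight (R * dilation c t) d

theorem multiplierMajorant_le (hR : 0 ≤ R) (hc : 0 ≤ c) (ht : 0 ≤ t) (d : ℕ) :
    multiplierMajorant R c d t ≤ 8 * Real.exp (c * t) * weight (R * dilation c t) d := by
  have hl := one_le_dilation hc ht
  have := weight_nonneg (S := R * dilation c t) (by positivity) d
  unfold multiplierMajorant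
  gcongr
  exact growthFactor_le c d t

theorem mul_multiplierMajorant_le (hR : 0 ≤ R) (hc : 0 ≤ c) (ht : 0 ≤ t) (d : ℕ) :
    d * multiplierMajorant R c d t ≤
      8 * Real.exp (c * t) ^ 2 * weight (R * dilation c t) d := by
  have hl := one_le_dilation hc ht
  have := weight_nonneg (S := R * dilation c t) (by positivity) d
  calc d * multiplierMajorant R c d t
      = 8 * (d * growthFactor c d t) * weight (R * dilation c t) d := by
        unfold multiplierMajorant; ring
    _ ≤ 8 * Real.exp (c * t) ^ 2 * weight (R * dilation c t) d := by
        gcongr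
        exact mul_growthFactor_le c d t

theorem hasDerivAt_multiplierMajorant (R c : ℝ) (d : ℕ) (t : ℝ) :
    HasDerivAt (multiplierMajorant R c d) (8 * weight R d *
      (c * growthFactor c d t * (1 + d / (Real.exp (c * t) + d)) * dilation c t ^ d +
        growthFactor c d t * (d * dilation c t ^ (d - 1) * (c * Real.exp (-(c * t)))))) t := by
  refine (((hasDerivAt_growthFactor c d t).mul ((hasDerivAt_dilation c t).pow d)).const_mul
    (8 * weight R d)).congr_of_eventuallyEq (.of_eq (funext fun s => ?_))
  simp only [multiplierMajorant, weight_mul, Pi.mul_apply, Pi.pow_apply]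
  ring

theorem le_deriv_multiplierMajorant (hR : 0 ≤ R) (hc : 0 ≤ c) (ht : 0 ≤ t) (d : ℕ) :
    4 * c * Real.exp (c * t) * weight (R * dilation c t) d ≤
      deriv (multiplierMajorant R c d) t := by
  rw [(hasDerivAt_multiplierMajorant R c d t).deriv, weight_mul, Real.exp_neg]
  set E := Real.exp (c * t) with hE
  have hE0 : 0 < E := Real.exp_pos _
  have hl := one_le_dilation hc ht
  have hg := growthFactor_nonneg c d t
  have hw := weight_nonneg hR d
  have hpow : d * (dilation c t ^ d / 2) ≤ d * dilation c t ^ (d - 1) := by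
    rcases d with _ | d
    · simp
    · rw [Nat.add_sub_cancel, pow_succ]
      gcongr
      linarith [mul_le_mul_of_nonneg_left (dilation_le_two c t)
        (show 0 ≤ dilation c t ^ d by positivity)]
  have hfactor : E / 2 ≤ growthFactor c d t * (1 + d / (2 * E)) := by
    rw [growthFactor, ← hE]
    field_simp
    nlinarith [d.cast_nonneg (α := ℝ)]
  calc 4 * c * E * (weight R d * dilation c t ^ d)
      = 8 * weight R d * c * dilation c t ^ d * (E / 2) := by ring
    _ ≤ 8 * weight R d * c * dilation c t ^ d * (growthFactor c d t * (1 + d / (2 * E))) := by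
        gcongr
    _ = 8 * weight R d * (c * growthFactor c d t * 1 * dilation c t ^ d +
          growthFactor c d t * (d * (dilation c t ^ d / 2) * (c * E⁻¹))) := by
        field_simp
    _ ≤ _ := by
        gcongr
        exact le_add_of_nonneg_right (by positivity)

/-- The majorant of the homogeneous part of degree `d` of the decrease of `N⁰`, up to an additive
constant. -/
def averageMajorant (A R c : ℝ) (d : ℕ) (t : ℝ) : ℝ :=
  A * weight R d / (d + 1) * dilation c t ^ (d + 1)

theorem hasDerivAt_averageMajorant (A R c : ℝ) (d : ℕ) (t : ℝ) :
    HasDerivAt (averageMajorant A R c d)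
      (A * weight (R * dilation c t) d * (c * Real.exp (-(c * t)))) t := by
  refine (((hasDerivAt_dilation c t).pow (d + 1)).const_mul
    (A * weight R d / (d + 1))).congr_deriv ?_
  rw [weight_mul]
  push_cast
  field_simp

theorem mul_averageMajorant_sub_le {A : ℝ} (hA : 0 ≤ A) (hR : 0 ≤ R) (hc : 0 ≤ c) (ht : 0 ≤ t)
    (d : ℕ) : d * (averageMajorant A R c d t - averageMajorant A R c d 0) ≤
      A * weight R d * (dilation c t ^ (d + 1) - 1) := by
  have hw := weight_nonneg hR d
  have hpow : 0 ≤ dilation c t ^ (d + 1) - 1 := sub_nonneg.2 (one_le_pow₀ (one_le_dilation hc ht))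
  calc d * (averageMajorant A R c d t - averageMajorant A R c d 0)
      = A * weight R d * (dilation c t ^ (d + 1) - 1) * (d / (d + 1)) := by
        rw [averageMajorant, averageMajorant, dilation_zero]; ring
    _ ≤ A * weight R d * (dilation c t ^ (d + 1) - 1) :=
        mul_le_of_le_one_right (by positivity) ((div_le_one (by positivity)).2 (by simp))

theorem homNorm_one_le_multiplierMajorant {σ R' : Type*} [Fintype σ] [DecidableEq σ]
    [NormedRing R'] [NormOneClass R'] (hR : 0 ≤ R) (hc : 0 ≤ c) (ht : 0 ≤ t) (d : ℕ) :
    homNorm d (1 : MvPowerSeries σ R') ≤ multiplierMajorant R c d t := by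
  refine (homNorm_one_le d).trans ?_
  have hl := one_le_dilation hc ht
  split_ifs with hd
  · subst hd
    have hmajorant : multiplierMajorant R c 0 t = Real.exp (c * t) := by
      simp only [multiplierMajorant, growthFactor, weight, pow_zero, Nat.cast_zero]
      field_simp
      ring
    rw [hmajorant]
    exact Real.one_le_exp (mul_nonneg hc ht)
  · exact mul_nonneg (mul_nonneg (by norm_num) (growthFactor_nonneg c d t))
      (weight_nonneg (by positivity) d)

end TimeDependentMajorants

section SmallData

variable {n : ℕ} {q : Fin n → ℤ} {P M : FormalSeries n} {U : ℝ → FormalSeries n}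
  {c t A B R : ℝ}

/-- The smallness of the data `P = κ^{[q]} N̂^{-q} N̂^q` and `M = N̂⁰`, relative to `c = ω_q / 2`
and to the scale `R` of the majorants, under which `multiplierMajorant R c` is preserved by the
Picard operator. -/
structure SmallData (q : Fin n → ℤ) (P M : FormalSeries n) (c R A B : ℝ) : Prop where
  c_pos : 0 < c
  R_pos : 0 < R
  le_order : 5 ≤ P.order
  le_order_average : 3 ≤ M.order
  majorized : Majorized B R P
  majorized_euler : Majorized B R (euler P)
  majorized_euler_average : Majorized A R (euler M)
  small_average : 8 * (oneNorm q * A * R ^ 2) ≤ c / 2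
  small : 1536 * (oneNorm q * B * R ^ 2) ≤ A * c

theorem eventually_smallData {α β : ℝ} (hq : q ≠ 0) (hc : 0 < c) (hPo : 5 ≤ P.order)
    (hMo : 3 ≤ M.order) (hP : ∀ᶠ S in atTop, Majorized α S P)
    (hM : ∀ᶠ S in atTop, Majorized β S M) :
    ∀ᶠ R in atTop, ∃ A B, SmallData q P M c R A B := by
  obtain ⟨S, hP, hM, hS⟩ := (hP.and (hM.and (eventually_gt_atTop 0))).exists
  have hQ := oneNorm_pos hq
  obtain ⟨K, hK⟩ : ∃ K, K = c / (16 * oneNorm q) := ⟨_, rfl⟩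
  obtain ⟨L, hL⟩ : ∃ L, L = c * K / (1536 * oneNorm q) := ⟨_, rfl⟩
  have hK0 : 0 < K := by rw [hK]; positivity
  have hL0 : 0 < L := by rw [hL]; positivity
  have hP4 : ((4 : ℕ) : ℕ∞) < P.order := lt_of_lt_of_le (by norm_num) hPo
  have hM2 : ((2 : ℕ) : ℕ∞) < M.order := lt_of_lt_of_le (by norm_num) hMo
  have hS2 : 0 < S * 2 := by positivity
  filter_upwards [hP.eventually_of_lt_order hS hP4 hL0,
    hP.euler.eventually_of_lt_order hS2 (hP4.trans_le (order_le_order_euler P)) hL0,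
    hM.euler.eventually_of_lt_order hS2 (hM2.trans_le (order_le_order_euler M)) hK0,
    eventually_gt_atTop 0] with R hPR hPR' hMR hR
  refine ⟨K / R ^ 2, L / R ^ 4, hc, hR, hPo, hMo, hPR, hPR', hMR, le_of_eq ?_, le_of_eq ?_⟩
  · rw [hK]; field_simp; norm_num
  · rw [hL]; field_simp

/-- The curves of normal forms whose homogeneous parts of degree `d` are dominated by
`multiplierMajorant R c d` at every time `t ≥ 0`. -/
def majorizedCurves (n : ℕ) (c R : ℝ) : Set (ℝ → FormalSeries n) :=
  {U | Continuous U ∧ (∀ t, U t ∈ normalForms n) ∧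
    ∀ t, 0 ≤ t → ∀ d, homNorm d (U t) ≤ multiplierMajorant R c d t}

theorem one_mem_majorizedCurves (hR : 0 ≤ R) (hc : 0 ≤ c) :
    (fun _ => 1) ∈ majorizedCurves n c R :=
  ⟨continuous_const, fun _ => (normalFormSubalgebra n).one_mem,
    fun _ ht d => homNorm_one_le_multiplierMajorant hR hc ht d⟩

theorem mem_majorizedCurves_of_forall_le_order_sub
    (h : ∀ d : ℕ, ∃ V ∈ majorizedCurves n c R, ∀ t, (d : ℕ∞) ≤ (U t - V t).order) :
    U ∈ majorizedCurves n c R := by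
  have hd : ∀ d : ℕ, ∃ V ∈ majorizedCurves n c R, ∀ t, (d : ℕ∞) < (U t - V t).order := fun d =>
    let ⟨V, hV, hUV⟩ := h (d + 1)
    ⟨V, hV, fun t => (Nat.cast_lt.2 d.lt_succ_self).trans_le (hUV t)⟩
  refine ⟨continuous_pi fun k => ?_, fun t k hk => ?_, fun t ht d => ?_⟩
  · obtain ⟨V, hV, hUV⟩ := hd k.degree
    exact ((WithPiTopology.continuous_coeff ℂ k).comp hV.1).congr
      fun t => (coeff_eq_of_lt_order_sub (hUV t)).symm
  · obtain ⟨V, hV, hUV⟩ := hd k.degree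
    exact hV.2.1 t k (by rwa [← coeff_eq_of_lt_order_sub (hUV t)])
  · obtain ⟨V, hV, hUV⟩ := hd d
    exact (homNorm_eq_of_lt_order_sub (hUV t)).trans_le (hV.2.2 t ht d)

theorem majorized_of_mem_majorizedCurves (hU : U ∈ majorizedCurves n c R) (hR : 0 ≤ R)
    (hc : 0 ≤ c) (ht : 0 ≤ t) : Majorized (8 * Real.exp (c * t)) (R * dilation c t) (U t) :=
  fun d => (hU.2.2 t ht d).trans (multiplierMajorant_le hR hc ht d)

theorem majorized_euler_of_mem_majorizedCurves (hU : U ∈ majorizedCurves n c R) (hR : 0 ≤ R)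
    (hc : 0 ≤ c) (ht : 0 ≤ t) :
    Majorized (8 * Real.exp (c * t) ^ 2) (R * dilation c t) (euler (U t)) := fun d => by
  rw [homNorm_euler]
  exact (mul_le_mul_of_nonneg_left (hU.2.2 t ht d) d.cast_nonneg).trans
    (mul_multiplierMajorant_le hR hc ht d)

namespace SmallData

theorem majorized_euler_mul_mul (h : SmallData q P M c R A B) (hU : U ∈ majorizedCurves n c R)
    (ht : 0 ≤ t) :
    Majorized (192 * B * Real.exp (c * t) ^ 3) (R * dilation c t) (euler (P * U t * U t)) := by
  have hR := h.R_pos.le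
  have hc := h.c_pos.le
  have hRS : R ≤ R * dilation c t := le_mul_of_one_le_right hR (one_le_dilation hc ht)
  have hS := hR.trans hRS
  have hP := h.majorized.mono le_rfl hR hRS
  have hP' := h.majorized_euler.mono le_rfl hR hRS
  have hUt := majorized_of_mem_majorizedCurves hU hR hc ht
  have hU' := majorized_euler_of_mem_majorizedCurves hU hR hc ht
  have hB := hP.nonneg
  have hE : 1 ≤ Real.exp (c * t) := Real.one_le_exp (mul_nonneg hc ht)
  rw [euler_mul, euler_mul]
  refine ((((hP'.mul hUt hS).add (hP.mul hU' hS)).mul hUt hS).add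
    ((hP.mul hUt hS).mul hU' hS)).mono ?_ hS le_rfl
  set E := Real.exp (c * t)
  calc (B * (8 * E) + B * (8 * E ^ 2)) * (8 * E) + B * (8 * E) * (8 * E ^ 2)
      = 64 * B * E ^ 2 * (1 + 2 * E) := by ring
    _ ≤ 64 * B * E ^ 2 * (E + 2 * E) := by gcongr
    _ = 192 * B * E ^ 3 := by ring

theorem majorized_averageRate (h : SmallData q P M c R A B) (hU : U ∈ majorizedCurves n c R)
    (ht : 0 ≤ t) :
    Majorized (A * (c * Real.exp (-(c * t)))) (R * dilation c t)
      (averageRate (2 * c) q P U t) := by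
  have hl := one_le_dilation h.c_pos.le ht
  have hR := h.R_pos
  have hS : 0 ≤ R * dilation c t := by positivity
  have hQ := oneNorm_nonneg q
  have hB := h.majorized.nonneg
  refine (((h.majorized_euler_mul_mul hU ht).dirDeriv q hS).smul _).mono ?_ hS le_rfl
  have hexp : Real.exp (-2 * (2 * c) * t) = (Real.exp (c * t) ^ 4)⁻¹ := by
    rw [← Real.exp_nat_mul, ← Real.exp_neg]; push_cast; ring_nf
  rw [Complex.norm_real, Real.norm_of_nonneg (by positivity), hexp, Real.exp_neg]
  set E := Real.exp (c * t)
  calc 2 * (E ^ 4)⁻¹ * (oneNorm q * (192 * B * E ^ 3) * (R * dilation c t) ^ 2)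
      ≤ 2 * (E ^ 4)⁻¹ * (oneNorm q * (192 * B * E ^ 3) * (R * 2) ^ 2) := by
        gcongr
        exact dilation_le_two c t
    _ = 1536 * (oneNorm q * B * R ^ 2) * E⁻¹ := by field_simp; ring
    _ ≤ A * c * E⁻¹ := mul_le_mul_of_nonneg_right h.small (by positivity)
    _ = A * (c * E⁻¹) := mul_assoc _ _ _

theorem homNorm_averagePart_sub_le (h : SmallData q P M c R A B)
    (hU : U ∈ majorizedCurves n c R) {a : ℝ} (ha : 0 ≤ a) (hat : a ≤ t) (d : ℕ) :
    homNorm d (averagePart (2 * c) q P M U a - averagePart (2 * c) q P M U t) ≤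
      averageMajorant A R c d t - averageMajorant A R c d a := by
  rw [averagePart, averagePart, sub_sub_sub_cancel_left]
  refine homNorm_primitive_sub_le (continuous_averageRate _ q hU.1) hat
    (fun s _ => hasDerivAt_averageMajorant A R c d s)
    fun s hs => (h.majorized_averageRate hU (ha.trans hs) d).trans_eq (by ring)

theorem majorized_euler_averagePart (h : SmallData q P M c R A B)
    (hU : U ∈ majorizedCurves n c R) (ht : 0 ≤ t) :
    Majorized (2 * A) (R * dilation c t) (euler (averagePart (2 * c) q P M U t)) := fun d => by
  have hl := one_le_dilation h.c_pos.le ht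
  have hA := h.majorized_euler_average.nonneg
  have hw := weight_nonneg h.R_pos.le d
  have hM := h.majorized_euler_average d
  rw [homNorm_euler] at hM ⊢
  have hN := homNorm_sub_le d M
    (averagePart (2 * c) q P M U 0 - averagePart (2 * c) q P M U t)
  have hdecrease := h.homNorm_averagePart_sub_le hU le_rfl ht d
  rw [averagePart_zero] at hN hdecrease
  rw [sub_sub_cancel] at hN
  calc d * homNorm d (averagePart (2 * c) q P M U t)
      ≤ d * homNorm d M + d * (averageMajorant A R c d t - averageMajorant A R c d 0) := by
        rw [← mul_add]
        gcongr
        exact hN.trans (by gcongr)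
    _ ≤ A * weight R d + A * weight R d * (dilation c t ^ (d + 1) - 1) :=
        add_le_add hM (mul_averageMajorant_sub_le hA h.R_pos.le h.c_pos.le ht d)
    _ = A * weight R d * (dilation c t ^ d * dilation c t) := by ring
    _ ≤ A * weight R d * (dilation c t ^ d * 2) := by
        gcongr
        exact dilation_le_two c t
    _ = 2 * A * weight (R * dilation c t) d := by rw [weight_mul]; ring

theorem majorized_dirDeriv_averagePart (h : SmallData q P M c R A B)
    (hU : U ∈ majorizedCurves n c R) (ht : 0 ≤ t) :
    Majorized (c / 2) (R * dilation c t) (dirDeriv q (averagePart (2 * c) q P M U t)) := by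
  have hl := one_le_dilation h.c_pos.le ht
  have hR := h.R_pos
  have hS : 0 ≤ R * dilation c t := by positivity
  have hQ := oneNorm_nonneg q
  have hA := h.majorized_euler_average.nonneg
  refine ((h.majorized_euler_averagePart hU ht).dirDeriv q hS).mono ?_ hS le_rfl
  calc oneNorm q * (2 * A) * (R * dilation c t) ^ 2 ≤ oneNorm q * (2 * A) * (R * 2) ^ 2 := by
        gcongr; exact dilation_le_two c t
    _ = 8 * (oneNorm q * A * R ^ 2) := by ring
    _ ≤ c / 2 := h.small_average

theorem mapsTo_picard (h : SmallData q P M c R A B) (hP : P ∈ normalForms n)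
    (hM : M ∈ normalForms n) :
    Set.MapsTo (picard (2 * c) q P M) (majorizedCurves n c R) (majorizedCurves n c R) := by
  intro U hU
  have hc := h.c_pos.le
  have hR := h.R_pos.le
  refine ⟨continuous_picard _ q M hU.1, picard_mem_normalForms _ q hP hM hU.2.1,
    fun t ht d => ?_⟩
  have hgrowth := homNorm_primitive_sub_le (continuous_mul_dirDeriv_averagePart (2 * c) q M hU.1)
    (d := d) (g := multiplierMajorant R c d) ht
    (fun s _ => (hasDerivAt_multiplierMajorant R c d s).differentiableAt.hasDerivAt)
    fun s hs => by
      have hl := one_le_dilation hc hs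
      refine (((majorized_of_mem_majorizedCurves hU hR hc hs).mul
        (h.majorized_dirDeriv_averagePart hU hs) (by positivity) d).trans_eq ?_).trans
        (le_deriv_multiplierMajorant hR hc hs d)
      ring
  rw [primitive_zero, sub_zero] at hgrowth
  calc homNorm d (picard (2 * c) q P M U t)
      ≤ multiplierMajorant R c d 0 + (multiplierMajorant R c d t - multiplierMajorant R c d 0) :=
        (homNorm_sub_le d _ _).trans
          (add_le_add (homNorm_one_le_multiplierMajorant hR hc le_rfl d) hgrowth)
    _ = multiplierMajorant R c d t := add_sub_cancel _ _

theorem exists_picard_eq (h : SmallData q P M c R A B) (hP : P ∈ normalForms n)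
    (hM : M ∈ normalForms n) : ∃ U ∈ majorizedCurves n c R, picard (2 * c) q P M U = U :=
  exists_fixedPoint_of_le_order_sub
    (fun _ _ _ => le_order_picard_sub _ q h.le_order h.le_order_average)
    ⟨_, one_mem_majorizedCurves h.R_pos.le h.c_pos.le⟩ (h.mapsTo_picard hP hM)
    fun _ => mem_majorizedCurves_of_forall_le_order_sub

end SmallData

end SmallData

section Limit

variable {n : ℕ} {q : Fin n → ℤ} {P M F : FormalSeries n} {U : ℝ → FormalSeries n}
  {c t A B C R ρ : ℝ}

theorem tendsto_exp_neg_mul_atTop (hc : 0 < c) :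
    Tendsto (fun t => Real.exp (-(c * t))) atTop (𝓝 0) :=
  Real.tendsto_exp_neg_atTop_nhds_zero.comp (tendsto_id.const_mul_atTop hc)

theorem tendsto_supNorm_of_majorized {ι : Type*} {l : Filter ι} {γ : ι → FormalSeries n}
    {g : ι → ℝ} {S : ℝ} (hS : 0 ≤ S) (hρ : 0 ≤ ρ) (hSρ : S * ρ ≤ 1) (hg : Tendsto g l (𝓝 0))
    (h : ∀ᶠ i in l, Majorized (g i) S (γ i)) : Tendsto (fun i => supNorm ρ (γ i)) l (𝓝 0) :=
  squeeze_zero' (.of_forall fun i => supNorm_nonneg ρ (γ i))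
    (h.mono fun _ hi => hi.supNorm_le hS hρ hSρ) hg

theorem majorized_mul_of_mem_majorizedCurves (hF : Majorized C R F)
    (hU : U ∈ majorizedCurves n c R) (hR : 0 ≤ R) (hc : 0 ≤ c) (ht : 0 ≤ t) :
    Majorized (C * (8 * Real.exp (c * t))) (R * 2) (F * U t) := by
  have hl := one_le_dilation hc ht
  exact (hF.mono le_rfl hR (by linarith)).mul
    ((majorized_of_mem_majorizedCurves hU hR hc ht).mono le_rfl (by positivity)
      (mul_le_mul_of_nonneg_left (dilation_le_two c t) hR)) (by positivity)

theorem mul_mem_boundedAnalytic_of_mem_majorizedCurves (hF : Majorized C R F)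
    (hU : U ∈ majorizedCurves n c R) (hR : 0 ≤ R) (hc : 0 ≤ c) (hρ : 0 ≤ ρ) (hRρ : R * 2 * ρ ≤ 1)
    (ht : 0 ≤ t) : F * U t ∈ boundedAnalytic n ρ :=
  (majorized_mul_of_mem_majorizedCurves hF hU hR hc ht).mem_boundedAnalytic (by positivity) hρ hRρ

theorem tendsto_supNorm_exp_smul_mul (hF : Majorized C R F) (hU : U ∈ majorizedCurves n c R)
    (hR : 0 ≤ R) (hc : 0 < c) (hρ : 0 ≤ ρ) (hRρ : R * 2 * ρ ≤ 1) :
    Tendsto (fun t : ℝ => supNorm ρ ((Real.exp (-(2 * c) * t) : ℂ) • (F * U t))) atTop (𝓝 0) := by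
  have hg := (tendsto_exp_neg_mul_atTop hc).const_mul (8 * C)
  rw [mul_zero] at hg
  refine tendsto_supNorm_of_majorized (by positivity) hρ hRρ hg
    ((eventually_ge_atTop 0).mono fun t ht => ?_)
  have hexp : Real.exp (-(2 * c) * t) * Real.exp (c * t) = Real.exp (-(c * t)) := by
    rw [← Real.exp_add]; ring_nf
  refine ((majorized_mul_of_mem_majorizedCurves hF hU hR hc.le ht).smul _).mono
    (le_of_eq ?_) (by positivity) le_rfl
  rw [Complex.norm_real, Real.norm_of_nonneg (Real.exp_pos _).le, ← hexp]
  ring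

namespace SmallData

theorem majorized_averagePart_sub (h : SmallData q P M c R A B) (hU : U ∈ majorizedCurves n c R)
    {a : ℝ} (ha : 0 ≤ a) (hat : a ≤ t) : Majorized (A * Real.exp (-(c * a))) (R * 2)
      (averagePart (2 * c) q P M U a - averagePart (2 * c) q P M U t) := fun d => by
  have hR := h.R_pos
  have hA := h.majorized_euler_average.nonneg
  have hw := weight_nonneg (S := R * 2) (by positivity) d
  let g : ℝ → ℝ := fun s => -(A * weight (R * 2) d * Real.exp (-c * s))
  have hg : ∀ s, HasDerivAt g (A * (c * Real.exp (-(c * s))) * weight (R * 2) d) s := fun s =>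
    ((hasDerivAt_exp_mul (-c) s).const_mul (A * weight (R * 2) d)).neg.congr_deriv (by ring_nf)
  have hrate : ∀ s, a ≤ s → homNorm d (averageRate (2 * c) q P U s) ≤
      A * (c * Real.exp (-(c * s))) * weight (R * 2) d := fun s hs => by
    have hl := one_le_dilation h.c_pos.le (ha.trans hs)
    exact ((h.majorized_averageRate hU (ha.trans hs)).mono le_rfl
      (mul_nonneg hR.le (zero_le_one.trans hl))
      (mul_le_mul_of_nonneg_left (dilation_le_two c s) hR.le) d)
  rw [averagePart, averagePart, sub_sub_sub_cancel_left]
  calc _ ≤ g t - g a :=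
        homNorm_primitive_sub_le (continuous_averageRate _ q hU.1) hat (fun s _ => hg s) hrate
    _ ≤ -g a := by
        rw [sub_le_iff_le_add, neg_add_cancel]
        exact neg_nonpos.2 (by positivity)
    _ = A * Real.exp (-(c * a)) * weight (R * 2) d := by simp only [g]; ring_nf

theorem tendsto_mul_exp (h : SmallData q P M c R A B) :
    Tendsto (fun t => A * Real.exp (-(c * t))) atTop (𝓝 0) := by
  simpa using (tendsto_exp_neg_mul_atTop h.c_pos).const_mul A

theorem exists_tendsto_averagePart (h : SmallData q P M c R A B)
    (hU : U ∈ majorizedCurves n c R) :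
    ∃ L, Tendsto (averagePart (2 * c) q P M U) atTop (𝓝 L) ∧ ∀ t, 0 ≤ t →
      Majorized (A * Real.exp (-(c * t))) (R * 2) (averagePart (2 * c) q P M U t - L) :=
  exists_tendsto_of_majorized_sub h.tendsto_mul_exp fun _ _ => h.majorized_averagePart_sub hU

theorem majorized_of_majorized_sub (h : SmallData q P M c R A B) (hM : Majorized C R M)
    (hF : Majorized (A * Real.exp (-(c * 0))) (R * 2) (averagePart (2 * c) q P M U 0 - F)) :
    Majorized (C + A) (R * 2) F := by
  have hR := h.R_pos.le
  rw [averagePart_zero, mul_zero, neg_zero, Real.exp_zero, mul_one] at hF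
  simpa using (hM.mono le_rfl hR (by linarith : R ≤ R * 2)).sub hF

theorem averagePart_mem_boundedAnalytic (h : SmallData q P M c R A B) (hM : Majorized C R M)
    (hU : U ∈ majorizedCurves n c R) (hρ : 0 ≤ ρ) (hRρ : R * 2 * ρ ≤ 1) (ht : 0 ≤ t) :
    averagePart (2 * c) q P M U t ∈ boundedAnalytic n ρ :=
  (h.majorized_of_majorized_sub hM (h.majorized_averagePart_sub hU le_rfl ht)).mem_boundedAnalytic
    (mul_nonneg h.R_pos.le zero_le_two) hρ hRρ

theorem exists_tendsto_supNorm_averagePart_sub (h : SmallData q P M c R A B)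
    (hP : P ∈ normalForms n) (hM : M ∈ normalForms n) (hMR : Majorized C R M)
    (hU : U ∈ majorizedCurves n c R) (hρ : 0 ≤ ρ) (hRρ : R * 2 * ρ ≤ 1) :
    ∃ L ∈ normalForms n ∩ boundedAnalytic n ρ,
      Tendsto (fun t => supNorm ρ (averagePart (2 * c) q P M U t - L)) atTop (𝓝 0) := by
  obtain ⟨L, hlim, hrate⟩ := h.exists_tendsto_averagePart hU
  have hS : 0 ≤ R * 2 := mul_nonneg h.R_pos.le zero_le_two
  refine ⟨L, ⟨(isClosed_normalForms n).mem_of_tendsto hlim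
    (.of_forall (averagePart_mem_normalForms _ q hP hM hU.2.1)),
    (h.majorized_of_majorized_sub hMR (hrate 0 le_rfl)).mem_boundedAnalytic hS hρ hRρ⟩, ?_⟩
  exact tendsto_supNorm_of_majorized hS hρ hRρ h.tendsto_mul_exp
    ((eventually_ge_atTop 0).mono hrate)

end SmallData

end Limit

section Solution

variable {n : ℕ} {ω : Fin n → ℝ} {q : Fin n → ℤ} {Np' Nm' N0' : FormalSeries n}
  {γ Φ U : ℝ → FormalSeries n}

theorem SatisfiesODE.const_mul (h : SatisfiesODE γ Φ) (F : FormalSeries n) :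
    SatisfiesODE (fun t => F * γ t) (fun t => F * Φ t) := by
  classical
  intro δ hδ k
  simp only [coeff_mul]
  exact HasDerivWithinAt.fun_sum fun p _ => (h δ hδ p.2).const_mul _

theorem satisfiesODE_sub_primitive (hγ : Continuous γ) (F : FormalSeries n) :
    SatisfiesODE (fun t => F - primitive γ t) (fun t => -γ t) := fun δ _ k => by
  simp only [map_sub, map_neg]
  exact ((hasDerivAt_coeff_primitive hγ k δ).const_sub _).hasDerivWithinAt

theorem satisfiesODE_averagePart (w : ℝ) (q : Fin n → ℤ) (P M : FormalSeries n)
    (hU : Continuous U) :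
    SatisfiesODE (averagePart w q P M U) (fun t => -averageRate w q P U t) :=
  satisfiesODE_sub_primitive (continuous_averageRate w q hU) M

theorem satisfiesODE_picard (w : ℝ) (q : Fin n → ℤ) (P M : FormalSeries n) (hU : Continuous U) :
    SatisfiesODE (picard w q P M U) (fun t => -(U t * dirDeriv q (averagePart w q P M U t))) :=
  satisfiesODE_sub_primitive (continuous_mul_dirDeriv_averagePart w q M hU) 1

theorem isSolution_of_picard_eq (hNp : Np' ∈ normalForms n) (hNm : Nm' ∈ normalForms n)
    (hN0 : N0' ∈ normalForms n) (hU : Continuous U) (hUn : ∀ t, U t ∈ normalForms n)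
    (hfix : picard (freq ω q) q ((kappaPow fun j => (q j).natAbs) * Nm' * Np') N0' U = U) :
    IsSolution ω q Np' Nm' N0' (fun t => Np' * U t) (fun t => Nm' * U t)
      (averagePart (freq ω q) q ((kappaPow fun j => (q j).natAbs) * Nm' * Np') N0' U) := by
  set P := (kappaPow fun j => (q j).natAbs) * Nm' * Np' with hPdef
  have hP : P ∈ normalForms n := kappaPow_mul_mul_mem_normalForms _ hNm hNp
  have hU0 : U 0 = 1 := by rw [← hfix, picard_zero]
  have hode := satisfiesODE_picard (freq ω q) q P N0' hU
  rw [hfix] at hode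
  refine ⟨fun t _ => ⟨(normalFormSubalgebra n).mul_mem hNp (hUn t),
    (normalFormSubalgebra n).mul_mem hNm (hUn t), averagePart_mem_normalForms _ q hP hN0 hUn t⟩,
    by simp only [hU0, mul_one], by simp only [hU0, mul_one], averagePart_zero _ q N0' P U,
    ?_, ?_, ?_⟩
  · simpa only [mul_neg, mul_assoc] using hode.const_mul Np'
  · simpa only [mul_neg, mul_assoc] using hode.const_mul Nm'
  · convert satisfiesODE_averagePart (freq ω q) q P N0' hU using 2 with t
    rw [averageRate, ← neg_smul, ← Complex.ofReal_neg, ← neg_mul, hPdef]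
    ring_nf

theorem exists_smallData {c : ℝ} (hq : q ≠ 0) (hc : 0 < c)
    (hNp : Np' ∈ normalForms n ∩ analyticSeries n)
    (hNm : Nm' ∈ normalForms n ∩ analyticSeries n)
    (hN0 : N0' ∈ normalForms n ∩ analyticSeries n)
    (hOP : IsOrderKappa 3 ((kappaPow fun j => (q j).natAbs) * Nm' * Np'))
    (hO0 : IsOrderKappa 2 N0') :
    ∃ R Cp Cm C0 A B, SmallData q ((kappaPow fun j => (q j).natAbs) * Nm' * Np') N0' c R A B ∧
      Majorized Cp R Np' ∧ Majorized Cm R Nm' ∧ Majorized C0 R N0' := by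
  have hP := kappaPow_mul_mul_mem_normalForms (fun j => (q j).natAbs) hNm.1 hNp.1
  have hPo : 5 ≤ ((kappaPow fun j => (q j).natAbs) * Nm' * Np').order :=
    le_trans (by norm_num) (hOP.le_order hP)
  have hMo : 3 ≤ N0'.order := le_trans (by norm_num) (hO0.le_order hN0.1)
  obtain ⟨CP, hCP⟩ := eventually_majorized_kappaPow_mul_mul (fun j => (q j).natAbs) hNm.2 hNp.2
  obtain ⟨Cp, hCp⟩ := eventually_majorized_of_mem_analyticSeries hNp.2
  obtain ⟨Cm, hCm⟩ := eventually_majorized_of_mem_analyticSeries hNm.2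
  obtain ⟨C0, hC0⟩ := eventually_majorized_of_mem_analyticSeries hN0.2
  obtain ⟨R, ⟨A, B, hsmall⟩, hp, hm, h0⟩ := ((eventually_smallData hq hc hPo hMo hCP hC0).and
    (hCp.and (hCm.and hC0))).exists
  exact ⟨R, Cp, Cm, C0, A, B, hsmall, hp, hm, h0⟩

end Solution

end

end NormalizationFlow

open NormalizationFlow Filter Topology in
theorem mainTheorem3_general {n : ℕ} (ω : Fin n → ℝ) (q : Fin n → ℤ)
    (hωq : ∑ j, ω j * (q j : ℝ) ≠ 0) (Np' Nm' N0' : FormalSeries n)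
    (hNp : Np' ∈ normalForms n ∩ analyticSeries n)
    (hNm : Nm' ∈ normalForms n ∩ analyticSeries n)
    (hN0 : N0' ∈ normalForms n ∩ analyticSeries n)
    (hOP : IsOrderKappa 3 ((kappaPow fun j => (q j).natAbs) * Nm' * Np'))
    (hO0 : IsOrderKappa 2 N0') :
    ∃ ρ : ℝ, 0 < ρ ∧ ∃ Np Nm N0 : ℝ → FormalSeries n,
      IsSolution ω q Np' Nm' N0' Np Nm N0 ∧
      (∀ δ : ℝ, 0 ≤ δ →
        Np δ ∈ boundedAnalytic n ρ ∧ Nm δ ∈ boundedAnalytic n ρ ∧ N0 δ ∈ boundedAnalytic n ρ) ∧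
      Tendsto (fun δ : ℝ => supNorm ρ ((Real.exp (-(freq ω q) * δ) : ℂ) • Np δ)) atTop (𝓝 0) ∧
      Tendsto (fun δ : ℝ => supNorm ρ ((Real.exp (-(freq ω q) * δ) : ℂ) • Nm δ)) atTop (𝓝 0) ∧
      ∃ Ninf ∈ normalForms n ∩ boundedAnalytic n ρ,
        Tendsto (fun δ : ℝ => supNorm ρ (N0 δ - Ninf)) atTop (𝓝 0) := by
  have hq : q ≠ 0 := by rintro rfl; simp at hωq
  obtain ⟨c, hωc⟩ : ∃ c, freq ω q = 2 * c := ⟨freq ω q / 2, by ring⟩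
  have hc : 0 < c := by linarith [show 0 < freq ω q from abs_pos.2 hωq]
  have hP := kappaPow_mul_mul_mem_normalForms (fun j => (q j).natAbs) hNm.1 hNp.1
  obtain ⟨R, Cp, Cm, C0, A, B, hsmall, hp, hm, h0⟩ := exists_smallData hq hc hNp hNm hN0 hOP hO0
  have hR := hsmall.R_pos
  obtain ⟨ρ, hρ, hRρ⟩ : ∃ ρ, 0 < ρ ∧ R * 2 * ρ ≤ 1 := ⟨(R * 2)⁻¹, by positivity, mul_inv_le_one⟩
  obtain ⟨U, hU, hfix⟩ := hsmall.exists_picard_eq hP hN0.1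
  have hsol := isSolution_of_picard_eq (ω := ω) hNp.1 hNm.1 hN0.1 hU.1 hU.2.1 (hωc ▸ hfix)
  rw [hωc] at hsol ⊢
  exact ⟨ρ, hρ, _, _, _, hsol, fun t ht =>
    ⟨mul_mem_boundedAnalytic_of_mem_majorizedCurves hp hU hR.le hc.le hρ.le hRρ ht,
      mul_mem_boundedAnalytic_of_mem_majorizedCurves hm hU hR.le hc.le hρ.le hRρ ht,
      hsmall.averagePart_mem_boundedAnalytic h0 hU hρ.le hRρ ht⟩,
    tendsto_supNorm_exp_smul_mul hp hU hR.le hc hρ.le hRρ,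
    tendsto_supNorm_exp_smul_mul hm hU hR.le hc hρ.le hRρ,
    hsmall.exists_tendsto_supNorm_averagePart_sub hP hN0.1 h0 hU hρ.le hRρ⟩

open NormalizationFlow Filter Topology in
theorem mainTheorem3 {n : ℕ} (ω : Fin n → ℝ) (hω : Nonresonant ω)
    (q : Fin n → ℤ) (hq : q ≠ 0) (hσ : 0 < freqSign ω q)
    (Np' Nm' N0' : FormalSeries n)
    (hNp : Np' ∈ normalForms n ∩ analyticSeries n)
    (hNm : Nm' ∈ normalForms n ∩ analyticSeries n)
    (hN0 : N0' ∈ normalForms n ∩ analyticSeries n)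
    (hOp : IsOrder 3 (harmonicMonomial q * Np'))
    (hOm : IsOrder 3 (harmonicMonomial (-q) * Nm'))
    (hO0 : IsOrderKappa 2 N0') :
    ∃ ρ : ℝ, 0 < ρ ∧ ∃ Np Nm N0 : ℝ → FormalSeries n,
      IsSolution ω q Np' Nm' N0' Np Nm N0 ∧
      (∀ δ : ℝ, 0 ≤ δ →
        Np δ ∈ boundedAnalytic n ρ ∧ Nm δ ∈ boundedAnalytic n ρ ∧ N0 δ ∈ boundedAnalytic n ρ) ∧
      Tendsto (fun δ : ℝ => supNorm ρ ((Real.exp (-(freq ω q) * δ) : ℂ) • Np δ)) atTop (𝓝 0) ∧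
      Tendsto (fun δ : ℝ => supNorm ρ ((Real.exp (-(freq ω q) * δ) : ℂ) • Nm δ)) atTop (𝓝 0) ∧
      ∃ Ninf ∈ normalForms n ∩ boundedAnalytic n ρ,
        Tendsto (fun δ : ℝ => supNorm ρ (N0 δ - Ninf)) atTop (𝓝 0) :=
  mainTheorem3_general ω q (sign_eq_one_iff.1 (SignType.pos_iff.1 hσ)).ne' Np' Nm' N0' hNp hNm hN0
    (isOrderKappa_kappaPow_mul_mul hOp hOm) hO0
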